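/- Consider linear programs $\min\{\varphi(x) : x\in P\}$, where $P\subset\mathbb R^3$ is a simple $3$-dimensional polytope and $\varphi$ is a linear objective function in general position (no two vertices of $P$ have the same $\varphi$-value). The \emph{random edge rule}, at a vertex $v$, moves to one of the adjacent vertices of smaller $\varphi$-value, chosen uniformly at random, and stops when there is none. Let $E(v)$ be the expected number of steps it takes when started at $v$. Let $\lambda_{\mathrm{RE}}(n)$ be the supremum of $E(v)$ over all such linear programs whose polytope has exactly $n$ facets and over all vertices $v$, and let $\Lambda(\mathrm{RE})=\limsup_{n\to\infty}\lambda_{\mathrm{RE}}(n)/n$ be the linearity coefficient of the rule. \textbf{Theorem.} For every integer $k\ge 4$ and $n=k+10(k-2)$ there is such a linear program with exactly $n$ facets and a vertex $v_{\mathrm{start}}$ with $$E(v_{\mathrm{start}})=\tfrac{1897}{1408}\,n-\tfrac{5202}{1408}.$$ Consequently $$\Lambda(\mathrm{RE})\ \ge\ \tfrac{1897}{1408}\ >\ 1.3473 .$$ -/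

import Mathlib

open scoped ENNReal

/-- A linear program in three variables with `n` inequality constraints: minimize
`objective ⬝ᵥ x` subject to `normal i ⬝ᵥ x ≤ bound i` for all `i`. -/
structure LP3 (n : ℕ) where
  normal : Fin n → Fin 3 → ℝ
  bound : Fin n → ℝ
  objective : Fin 3 → ℝ

namespace LP3

variable {n : ℕ} (L : LP3 n)

/-- The feasible region. -/
def polytope : Set (Fin 3 → ℝ) := {x | ∀ i, L.normal i ⬝ᵥ x ≤ L.bound i}

/-- The part of the feasible region on which the `i`-th constraint is tight. -/
def facet (i : Fin n) : Set (Fin 3 → ℝ) := {x ∈ L.polytope | L.normal i ⬝ᵥ x = L.bound i}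

/-- The vertices of the feasible region. -/
def vertices : Set (Fin 3 → ℝ) := L.polytope.extremePoints ℝ

/-- The value of the objective function at a point. -/
def value (x : Fin 3 → ℝ) : ℝ := L.objective ⬝ᵥ x

/-- The feasible region is a simple 3-dimensional polytope with exactly `n` facets (one for each
constraint), and the objective function is in general position. -/
structure IsSimpleGeneric : Prop where
  bounded : Bornology.IsBounded L.polytope
  fullDim : (interior L.polytope).Nonempty
  /-- every constraint defines a facet, that is, a face of dimension 2 -/
  facet_dim : ∀ i, Module.finrank ℝ (vectorSpan ℝ (L.facet i)) = 2
  /-- different constraints define different facets -/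
  facet_injective : Function.Injective L.facet
  /-- every vertex lies on exactly three facets -/
  simple : ∀ v ∈ L.vertices, {i | v ∈ L.facet i}.ncard = 3
  /-- no two vertices have the same objective value -/
  generic : Set.InjOn L.value L.vertices

/-- Two points are adjacent if they are distinct vertices and the segment between them is an
edge, that is, a face of the feasible region. -/
def Adj (v w : Fin 3 → ℝ) : Prop :=
  v ∈ L.vertices ∧ w ∈ L.vertices ∧ v ≠ w ∧ IsExposed ℝ L.polytope (segment ℝ v w)

/-- The improving neighbours of `v`: the adjacent vertices with a smaller objective value. -/
def improving (v : Fin 3 → ℝ) : Set (Fin 3 → ℝ) := {w | L.Adj v w ∧ L.value w < L.value v}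

theorem vertices_finite : L.vertices.Finite := by
  refine Set.Finite.of_finite_image (f := fun x => {i | L.normal i ⬝ᵥ x = L.bound i})
    (Set.toFinite _) ?_
  intro x hx y hy hxy
  have hxP : x ∈ L.polytope := hx.1
  have hyP : y ∈ L.polytope := hy.1
  have key : ∀ i, ∃ ε : ℝ, 0 < ε ∧ ∀ δ, 0 ≤ δ → δ ≤ ε →
      L.normal i ⬝ᵥ (x - δ • (y - x)) ≤ L.bound i := by
    intro i
    by_cases hi : L.normal i ⬝ᵥ x = L.bound i
    · have hi' : L.normal i ⬝ᵥ y = L.bound i := by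
        have : i ∈ {i | L.normal i ⬝ᵥ x = L.bound i} := hi
        rw [show {i | L.normal i ⬝ᵥ x = L.bound i} = {i | L.normal i ⬝ᵥ y = L.bound i} from hxy]
          at this
        exact this
      refine ⟨1, one_pos, fun δ _ _ => ?_⟩
      simp [dotProduct_sub, dotProduct_smul, hi, hi']
    · have hlt : L.normal i ⬝ᵥ x < L.bound i := lt_of_le_of_ne (hxP i) hi
      have hpos : 0 < |L.normal i ⬝ᵥ (y - x)| + 1 := by positivity
      refine ⟨(L.bound i - L.normal i ⬝ᵥ x) / (|L.normal i ⬝ᵥ (y - x)| + 1),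
        div_pos (by linarith) hpos, fun δ h0 hδ => ?_⟩
      rw [le_div_iff₀ hpos] at hδ
      rw [dotProduct_sub, dotProduct_smul, smul_eq_mul]
      nlinarith [neg_abs_le (L.normal i ⬝ᵥ (y - x))]
  choose ε hε hεP using key
  obtain ⟨δ, hδ, hδε⟩ : ∃ δ : ℝ, 0 < δ ∧ ∀ i, δ ≤ ε i := by
    rcases isEmpty_or_nonempty (Fin n) with h | h
    · exact ⟨1, one_pos, fun i => h.elim i⟩
    · obtain ⟨j, hj⟩ := Finite.exists_min ε
      exact ⟨ε j, hε j, hj⟩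
  have hz : x - δ • (y - x) ∈ L.polytope := fun i => hεP i δ hδ.le (hδε i)
  have hopen : x ∈ openSegment ℝ (x - δ • (y - x)) y := by
    have h1 : (0 : ℝ) < 1 + δ := by linarith
    refine ⟨1 / (1 + δ), δ / (1 + δ), by positivity, by positivity, by field_simp, ?_⟩
    ext j
    simp only [Pi.add_apply, Pi.smul_apply, Pi.sub_apply, smul_eq_mul]
    field_simp
    ring
  have h := hx.2 hz hyP hopen
  have h' : δ • (y - x) = 0 := by simpa using h
  rcases smul_eq_zero.1 h' with h0 | h0
  · exact absurd h0 hδ.ne'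
  · exact (sub_eq_zero.1 h0).symm

theorem improving_finite (v : Fin 3 → ℝ) : (L.improving v).Finite :=
  L.vertices_finite.subset fun _ hw => hw.1.2.1

open Classical in
/-- One random edge pivot from `v`: an improving neighbour of `v` chosen uniformly at random;
the algorithm stays where it is when there is none. -/
noncomputable def randomEdge (v : Fin 3 → ℝ) : PMF (Fin 3 → ℝ) :=
  if h : (L.improving_finite v).toFinset.Nonempty then PMF.uniformOfFinset _ h else PMF.pure v

/-- The distribution of the current vertex after `t` rounds of the random edge rule,
started at `v`. -/
noncomputable def position (v : Fin 3 → ℝ) : ℕ → PMF (Fin 3 → ℝ)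
  | 0 => PMF.pure v
  | t + 1 => (position v t).bind L.randomEdge

/-- The expected number of pivot steps of the random edge rule, started at `v`. The
`(t + 1)`-st step is made exactly if the vertex reached after `t` rounds has an improving
neighbour, so the expectation is the sum over `t` of the probabilities of this event. -/
noncomputable def expectedSteps (v : Fin 3 → ℝ) : ℝ≥0∞ :=
  ∑' t : ℕ, (L.position v t).toOuterMeasure {w | (L.improving w).Nonempty}

end LP3

/-- The largest expected number of random edge steps, over all 3-dimensional linear programs
whose feasible region is a simple polytope with `n` facets and whose objective function is in
general position, and over all starting vertices. -/
noncomputable def maxExpectedStepsRE (n : ℕ) : ℝ≥0∞ :=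
  ⨆ (L : LP3 n) (_ : L.IsSimpleGeneric) (v : Fin 3 → ℝ) (_ : v ∈ L.vertices), L.expectedSteps v

/-- The linearity coefficient of the random edge rule. -/
noncomputable def linearityCoefficientRE : ℝ≥0∞ :=
  Filter.limsup (fun n : ℕ => maxExpectedStepsRE n / (n : ℝ≥0∞)) Filter.atTop

/-! A vertex `v` with a single improving edge is a bottleneck. Let `b` be the expected number of
steps from the lower end of that edge. Replace `v` by a tiny copy of a gadget, a simple polyhedron
whose recession cone is the orthant: its three unbounded edges are glued to the three edges at `v`,
and in the order of values the copy takes the place of `v`. A walk inside the copy can leave only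
through the old improving edge, and nothing below `v` changes. So each gadget vertex gets its own
expectation inside the gadget plus `b` (`Frame.insertLP_expectedSteps_insertVertex`).

`entryGadget` has 10 facets, and from its top vertex the walk takes `15176 / 1024 = 1897 / 128`
expected steps. To iterate, a new bottleneck is needed above that vertex. Truncating `v` beforehand
costs one more facet and provides it: the result is `chainGadget`, with 11 facets. Hence the slope
`(1897 / 128) / 11 = 1897 / 1408`. The chain (`extendable_chain`) begins with a tetrahedron whose
sink is replaced, having 14 facets, and ends with one untruncated gadget.

All geometry is reduced to finite data by `Frame`: a list of feasible points with their triples of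
tight constraints, closed under exchanging one constraint along an edge, is already the full vertex
list, and exchanges are exactly the edges (`Frame.vertices_eq`, `Frame.adj_iff`).
`Frame.insertFrame` shows that such descriptions survive an insertion; for the explicit polyhedra
they are verified by integer arithmetic. -/

namespace LP3

variable {n : ℕ} (L : LP3 n)

/-! ### First-step analysis of the random edge rule -/

theorem position_succ' (v : Fin 3 → ℝ) (t : ℕ) :
    L.position v (t + 1) = (L.randomEdge v).bind fun w => L.position w t := by
  induction t with
  | zero => simp [position]
  | succ t ih =>
    rw [position, ih, PMF.bind_bind]
    rfl

open Classical in
/-- First-step analysis of the random edge rule. -/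
theorem expectedSteps_eq_tsum (v : Fin 3 → ℝ) :
    L.expectedSteps v =
      (if (L.improving v).Nonempty then 1 else 0) +
        ∑' w, L.randomEdge v w * L.expectedSteps w := by
  rw [expectedSteps, tsum_eq_zero_add' ENNReal.summable]
  congr 1
  · simp [position, PMF.toOuterMeasure_pure_apply]
  · simp_rw [position_succ', PMF.toOuterMeasure_bind_apply, expectedSteps, ← ENNReal.tsum_mul_left]
    exact ENNReal.tsum_comm

theorem position_of_improving_eq_empty {v : Fin 3 → ℝ} (h : L.improving v = ∅) (t : ℕ) :
    L.position v t = PMF.pure v := by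
  have hr : L.randomEdge v = PMF.pure v := by
    rw [randomEdge, dif_neg]
    simp [h]
  induction t with
  | zero => rfl
  | succ t ih => rw [position, ih, PMF.pure_bind, hr]

theorem expectedSteps_of_improving_eq_empty {v : Fin 3 → ℝ} (h : L.improving v = ∅) :
    L.expectedSteps v = 0 := by
  rw [expectedSteps, ENNReal.tsum_eq_zero]
  intro t
  rw [L.position_of_improving_eq_empty h, PMF.toOuterMeasure_pure_apply, if_neg]
  simp [h]

theorem expectedSteps_of_improving_nonempty {v : Fin 3 → ℝ} (h : (L.improving v).Nonempty) :
    L.expectedSteps v = 1 +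
      (∑ w ∈ (L.improving_finite v).toFinset, L.expectedSteps w) /
        (L.improving_finite v).toFinset.card := by
  have h' : (L.improving_finite v).toFinset.Nonempty := by simpa using h
  rw [expectedSteps_eq_tsum, if_pos h, tsum_eq_sum (s := (L.improving_finite v).toFinset)]
  · rw [randomEdge, dif_pos h', ENNReal.div_eq_inv_mul, Finset.mul_sum]
    congr 1
    refine Finset.sum_congr rfl fun w hw => ?_
    rw [PMF.uniformOfFinset_apply_of_mem h' hw]
  · intro w hw
    rw [randomEdge, dif_pos h', PMF.uniformOfFinset_apply_of_notMem h' hw, zero_mul]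

/-- The two neighbours may coincide, since averaging a value with itself changes nothing. Thus a
vertex with one improving neighbour is treated like one with two, by listing the neighbour twice. -/
theorem expectedSteps_of_improving_eq_pair {v w₁ w₂ : Fin 3 → ℝ} (h : L.improving v = {w₁, w₂}) :
    L.expectedSteps v = 1 + (L.expectedSteps w₁ + L.expectedSteps w₂) / 2 := by
  classical
  rw [L.expectedSteps_of_improving_nonempty (by simp [h])]
  have hf : (L.improving_finite v).toFinset = {w₁, w₂} := by
    ext w; simp [h]
  rw [hf]
  by_cases hw : w₁ = w₂
  · subst hw
    simp only [Finset.mem_singleton, Finset.insert_eq_of_mem, Finset.sum_singleton,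
      Finset.card_singleton, Nat.cast_one, div_one]
    rw [← two_mul, mul_comm, ENNReal.mul_div_cancel_right two_ne_zero ENNReal.ofNat_ne_top]
  · rw [Finset.sum_pair hw, Finset.card_pair hw]
    rfl

theorem expectedSteps_of_improving_eq_pair_ofReal {v w₁ w₂ : Fin 3 → ℝ} {a b c : ℝ}
    (h : L.improving v = {w₁, w₂}) (ha : 0 ≤ a) (hb : 0 ≤ b)
    (h₁ : L.expectedSteps w₁ = ENNReal.ofReal a) (h₂ : L.expectedSteps w₂ = ENNReal.ofReal b)
    (hc : c = 1 + (a + b) / 2) :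
    L.expectedSteps v = ENNReal.ofReal c := by
  rw [L.expectedSteps_of_improving_eq_pair h, h₁, h₂, hc, ← ENNReal.ofReal_add ha hb,
    ENNReal.ofReal_add one_pos.le (by positivity), ENNReal.ofReal_one,
    ENNReal.ofReal_div_of_pos two_pos, ENNReal.ofReal_ofNat]

/-- The expected number of steps only depends on the part of the linear program that can be
reached. -/
theorem expectedSteps_congr {m : ℕ} {L : LP3 n} {M : LP3 m} {v : Fin 3 → ℝ}
    (himp : M.improving v = L.improving v)
    (h : ∀ w ∈ L.improving v, M.expectedSteps w = L.expectedSteps w) :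
    M.expectedSteps v = L.expectedSteps v := by
  rcases (L.improving v).eq_empty_or_nonempty with h0 | h0
  · rw [expectedSteps_of_improving_eq_empty _ h0,
      expectedSteps_of_improving_eq_empty _ (himp.trans h0)]
  · rw [expectedSteps_of_improving_nonempty _ h0,
      expectedSteps_of_improving_nonempty _ (himp ▸ h0)]
    have hf : (M.improving_finite v).toFinset = (L.improving_finite v).toFinset := by
      ext w; simp [himp]
    rw [hf, Finset.sum_congr rfl fun w hw => h w (by simpa using hw)]

end LP3

/-! ### Simple polytopes described by vertex lists -/

namespace LP3

variable {n : ℕ} {L : LP3 n} {V : Type}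

/-- In a family of triples, `y` arises from `x` by exchanging the `j`-th element of the triple. -/
structure Exchange {ι : Type} (t : V → Fin 3 → ι) (x : V) (j : Fin 3) (y : V) : Prop where
  keep : ∀ k, k ≠ j → ∃ l, t y l = t x k
  drop : ∀ l, t y l ≠ t x j

theorem exchange_iff {ι : Type} {t : V → Fin 3 → ι} {x y : V} {j : Fin 3} :
    Exchange t x j y ↔ (∀ k, k ≠ j → ∃ l, t y l = t x k) ∧ ∀ l, t y l ≠ t x j :=
  ⟨fun h => ⟨h.1, h.2⟩, fun h => ⟨h.1, h.2⟩⟩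

instance {ι : Type} [DecidableEq ι] (t : V → Fin 3 → ι) (x : V) (j : Fin 3) (y : V) :
    Decidable (Exchange t x j y) :=
  decidable_of_iff' _ exchange_iff

/-- A description of a simple generic linear program by the list of its vertices, each with the
three constraints that are tight there, such that the list is closed under moving along edges. -/
structure Frame (L : LP3 n) (V : Type) where
  pos : V → Fin 3 → ℝ
  t : V → Fin 3 → Fin n
  t_injective : ∀ x, Function.Injective (t x)
  tight : ∀ x j, L.normal (t x j) ⬝ᵥ pos x = L.bound (t x j)
  slack : ∀ x i, (∀ j, t x j ≠ i) → L.normal i ⬝ᵥ pos x < L.bound i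
  exists_exchange : ∀ x j, ∃ y, Exchange t x j y
  covers : ∀ i, ∃ x j, t x j = i
  value_injective : Function.Injective (L.value ∘ pos)

namespace Frame

variable (F : Frame L V)

theorem mem_polytope (x : V) : F.pos x ∈ L.polytope := by
  intro i
  by_cases h : ∃ j, F.t x j = i
  · obtain ⟨j, rfl⟩ := h
    exact (F.tight x j).le
  · push Not at h
    exact (F.slack x i h).le

theorem pos_injective : Function.Injective F.pos := fun _ _ h =>
  F.value_injective (congrArg L.value h)

theorem tight_iff (x : V) (i : Fin n) :
    L.normal i ⬝ᵥ F.pos x = L.bound i ↔ ∃ j, F.t x j = i := by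
  constructor
  · intro h
    by_contra! h'
    exact (F.slack x i h').ne h
  · rintro ⟨j, rfl⟩
    exact F.tight x j

/-- A neighbour of the vertex `x` in the direction that leaves the `j`-th constraint. -/
noncomputable def nb (x : V) (j : Fin 3) : V := (F.exists_exchange x j).choose

theorem nb_exchange (x : V) (j : Fin 3) : Exchange F.t x j (F.nb x j) :=
  (F.exists_exchange x j).choose_spec

variable {F} in
theorem _root_.LP3.Exchange.slack_lt {x y : V} {j : Fin 3} (h : Exchange F.t x j y) :
    L.normal (F.t x j) ⬝ᵥ F.pos y < L.bound (F.t x j) :=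
  F.slack y _ h.drop

variable {F} in
theorem _root_.LP3.Exchange.tight_eq {x y : V} {j k : Fin 3} (h : Exchange F.t x j y) (hk : k ≠ j) :
    L.normal (F.t x k) ⬝ᵥ F.pos y = L.bound (F.t x k) :=
  (F.tight_iff y _).2 (h.keep k hk)

variable {F} in
theorem _root_.LP3.Exchange.pos_ne {x y : V} {j : Fin 3} (h : Exchange F.t x j y) : F.pos y ≠ F.pos x := by
  intro he
  have := h.slack_lt
  rw [he, F.tight] at this
  exact lt_irrefl _ this

/-- The direction of the `j`-th edge at `x`. -/
noncomputable def dir (x : V) (j : Fin 3) : Fin 3 → ℝ := F.pos (F.nb x j) - F.pos x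

theorem normal_dir_self (x : V) (j : Fin 3) : L.normal (F.t x j) ⬝ᵥ F.dir x j < 0 := by
  rw [dir, dotProduct_sub, F.tight]
  linarith [(F.nb_exchange x j).slack_lt]

theorem normal_dir_of_ne (x : V) {j k : Fin 3} (h : k ≠ j) :
    L.normal (F.t x k) ⬝ᵥ F.dir x j = 0 := by
  rw [dir, dotProduct_sub, F.tight, (F.nb_exchange x j).tight_eq h, sub_self]

theorem normal_sum_dir (x : V) (a : Fin 3 → ℝ) (j : Fin 3) :
    L.normal (F.t x j) ⬝ᵥ ∑ k, a k • F.dir x k = a j * (L.normal (F.t x j) ⬝ᵥ F.dir x j) := by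
  rw [dotProduct_sum, Finset.sum_eq_single j]
  · rw [dotProduct_smul, smul_eq_mul]
  · intro k _ hk
    rw [dotProduct_smul, F.normal_dir_of_ne x hk.symm, smul_zero]
  · simp

/-- A point is determined by the values of the three constraints that are tight at a vertex. -/
theorem ext_of_normal (x : V) {p q : Fin 3 → ℝ}
    (h : ∀ j, L.normal (F.t x j) ⬝ᵥ p = L.normal (F.t x j) ⬝ᵥ q) : p = q := by
  let M : Matrix (Fin 3) (Fin 3) ℝ := Matrix.of fun j => L.normal (F.t x j)
  let D : Matrix (Fin 3) (Fin 3) ℝ := Matrix.of fun i j => F.dir x j i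
  have hMD : M * D = Matrix.diagonal fun j => L.normal (F.t x j) ⬝ᵥ F.dir x j := by
    ext i j
    have h1 : (M * D) i j = L.normal (F.t x i) ⬝ᵥ F.dir x j := rfl
    rw [h1]
    by_cases hij : i = j
    · subst hij; simp
    · rw [Matrix.diagonal_apply_ne _ hij, F.normal_dir_of_ne x hij]
  have hdet : M.det ≠ 0 := by
    intro h0
    have h1 : (M * D).det = 0 := by rw [Matrix.det_mul, h0, zero_mul]
    rw [hMD, Matrix.det_diagonal, Finset.prod_eq_zero_iff] at h1
    obtain ⟨j, -, hj⟩ := h1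
    exact (F.normal_dir_self x j).ne hj
  have hinj := Matrix.mulVec_injective_of_isUnit ((Matrix.isUnit_iff_isUnit_det M).2 hdet.isUnit)
  exact hinj (funext h)

/-- The coordinates of a point with respect to the edge directions at `x`. -/
noncomputable def coord (x : V) (p : Fin 3 → ℝ) (j : Fin 3) : ℝ :=
  (L.bound (F.t x j) - L.normal (F.t x j) ⬝ᵥ p) / -(L.normal (F.t x j) ⬝ᵥ F.dir x j)

theorem eq_pos_add_sum (x : V) (p : Fin 3 → ℝ) :
    p = F.pos x + ∑ j, F.coord x p j • F.dir x j := by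
  apply F.ext_of_normal x
  intro j
  have h := (F.normal_dir_self x j).ne
  rw [dotProduct_add, F.normal_sum_dir, F.tight, coord]
  field_simp
  ring

theorem coord_nonneg (x : V) {p : Fin 3 → ℝ} (hp : p ∈ L.polytope) (j : Fin 3) :
    0 ≤ F.coord x p j :=
  div_nonneg (by linarith [hp (F.t x j)]) (by linarith [F.normal_dir_self x j])

/-- The polytope lies in the cone spanned at `x` by the edge directions, so a local maximum of a
linear function along the edges is a global one. -/
theorem dotProduct_le_of_forall_dir (x : V) (c : Fin 3 → ℝ) (h : ∀ j, c ⬝ᵥ F.dir x j ≤ 0)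
    {p : Fin 3 → ℝ} (hp : p ∈ L.polytope) : c ⬝ᵥ p ≤ c ⬝ᵥ F.pos x := by
  rw [F.eq_pos_add_sum x p, dotProduct_add, dotProduct_sum]
  have : ∑ j, c ⬝ᵥ F.coord x p j • F.dir x j ≤ 0 := by
    refine Finset.sum_nonpos fun j _ => ?_
    rw [dotProduct_smul, smul_eq_mul]
    exact mul_nonpos_of_nonneg_of_nonpos (F.coord_nonneg x hp j) (h j)
  linarith

theorem mem_facet_iff (x : V) (i : Fin n) : F.pos x ∈ L.facet i ↔ ∃ j, F.t x j = i := by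
  rw [← F.tight_iff]
  exact ⟨fun h => h.2, fun h => ⟨F.mem_polytope x, h⟩⟩

variable {F} in
theorem _root_.LP3.Exchange.exists_slack {x y : V} {j : Fin 3} (h : Exchange F.t x j y) :
    ∃ l, L.normal (F.t y l) ⬝ᵥ F.pos x < L.bound (F.t y l) := by
  by_contra! hl
  have hl' : ∀ l, ∃ m, F.t x m = F.t y l := fun l =>
    (F.tight_iff x _).1 (le_antisymm (F.mem_polytope x _) (hl l))
  choose m hm using hl'
  have hinj : Function.Injective m := fun a b hab =>
    F.t_injective y (by rw [← hm, ← hm, hab])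
  obtain ⟨l, hlj⟩ := Finite.surjective_of_injective hinj j
  exact h.2 l (by rw [← hm, hlj])

/-- The barycentre of a vertex and its three neighbours is strictly feasible: each constraint tight
at the vertex is left by one of the neighbours. -/
theorem interior_nonempty (F : Frame L V) [Nonempty V] : (interior L.polytope).Nonempty := by
  obtain ⟨x⟩ : Nonempty V := inferInstance
  let p : Fin 3 → ℝ := (1 / 4 : ℝ) • (F.pos x + ∑ j, F.pos (F.nb x j))
  have hopen : IsOpen {y : Fin 3 → ℝ | ∀ i, L.normal i ⬝ᵥ y < L.bound i} := by
    simp only [Set.ofPred_forall]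
    exact isOpen_iInter_of_finite fun i =>
      isOpen_lt (continuous_const.dotProduct continuous_id) continuous_const
  have hsub : {y : Fin 3 → ℝ | ∀ i, L.normal i ⬝ᵥ y < L.bound i} ⊆ L.polytope :=
    fun y hy i => (hy i).le
  refine ⟨p, interior_maximal hsub hopen fun i => ?_⟩
  have hp : L.normal i ⬝ᵥ p = (1 / 4 : ℝ) * (L.normal i ⬝ᵥ F.pos x +
      ∑ j, L.normal i ⬝ᵥ F.pos (F.nb x j)) := by
    simp only [p, dotProduct_smul, dotProduct_add, dotProduct_sum, smul_eq_mul]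
  rw [hp, Fin.sum_univ_three]
  have h0 := F.mem_polytope x i
  have h1 := fun j => F.mem_polytope (F.nb x j) i
  by_cases hi : ∃ j, F.t x j = i
  · obtain ⟨j, rfl⟩ := hi
    have hj := (F.nb_exchange x j).slack_lt
    have h10 := h1 0
    have h11 := h1 1
    have h12 := h1 2
    rcases (by fin_cases j <;> simp : j = 0 ∨ j = 1 ∨ j = 2) with rfl | rfl | rfl <;> linarith
  · push Not at hi
    linarith [F.slack x i hi, h1 0, h1 1, h1 2]

theorem finrank_facet (F : Frame L V) (i : Fin n) : Module.finrank ℝ (vectorSpan ℝ (L.facet i)) = 2 := by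
  obtain ⟨x, j, rfl⟩ := F.covers i
  apply le_antisymm
  · let f : (Fin 3 → ℝ) →ₗ[ℝ] ℝ :=
      { toFun := fun y => L.normal (F.t x j) ⬝ᵥ y
        map_add' := fun y z => dotProduct_add _ _ _
        map_smul' := fun c y => dotProduct_smul _ _ _ }
    have hle : vectorSpan ℝ (L.facet (F.t x j)) ≤ LinearMap.ker f := by
      rw [vectorSpan_def, Submodule.span_le]
      rintro _ ⟨p, hp, q, hq, rfl⟩
      change L.normal (F.t x j) ⬝ᵥ (p - q) = 0
      rw [dotProduct_sub, hp.2, hq.2, sub_self]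
    have hlt : LinearMap.ker f < ⊤ := by
      rw [lt_top_iff_ne_top]
      intro h
      have : F.dir x j ∈ LinearMap.ker f := by rw [h]; trivial
      exact (F.normal_dir_self x j).ne this
    have h1 := Submodule.finrank_lt_finrank_of_lt hlt
    have h2 := Submodule.finrank_mono hle
    rw [finrank_top, Module.finrank_fin_fun] at h1
    omega
  · have hmem : ∀ k, k ≠ j → F.dir x k ∈ vectorSpan ℝ (L.facet (F.t x j)) := by
      intro k hk
      refine vsub_mem_vectorSpan ℝ ?_ ?_
      · rw [F.mem_facet_iff]; exact (F.nb_exchange x k).1 j hk.symm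
      · rw [F.mem_facet_iff]; exact ⟨j, rfl⟩
    have hli : LinearIndependent ℝ fun k : {k : Fin 3 // k ≠ j} => F.dir x k := by
      have hall : LinearIndependent ℝ (F.dir x) := by
        rw [Fintype.linearIndependent_iff]
        intro a ha k
        have := F.normal_sum_dir x a k
        rw [ha, dotProduct_zero] at this
        exact (mul_eq_zero.1 this.symm).resolve_right (F.normal_dir_self x k).ne
      exact hall.comp _ Subtype.val_injective
    have hcard := finrank_span_eq_card hli
    rw [Fintype.card_subtype_compl, Fintype.card_fin, Fintype.card_subtype_eq] at hcard
    have hle : Submodule.span ℝ (Set.range fun k : {k : Fin 3 // k ≠ j} => F.dir x k) ≤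
        vectorSpan ℝ (L.facet (F.t x j)) := by
      rw [Submodule.span_le]
      rintro _ ⟨k, rfl⟩
      exact hmem k k.2
    have := Submodule.finrank_mono hle
    omega

section Finite

variable [Finite V] [Nonempty V]

theorem exists_forall_dotProduct_le (c : Fin 3 → ℝ) :
    ∃ x, ∀ p ∈ L.polytope, c ⬝ᵥ p ≤ c ⬝ᵥ F.pos x := by
  obtain ⟨x, hx⟩ := Finite.exists_max fun x => c ⬝ᵥ F.pos x
  refine ⟨x, fun p hp => F.dotProduct_le_of_forall_dir x c (fun j => ?_) hp⟩
  rw [dir, dotProduct_sub]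
  linarith [hx (F.nb x j)]

/-- A point outside the hull of the listed vertices would be separated from it by a linear function.
But the listed vertex with the largest value beats its neighbours, which are listed too, and is
therefore optimal over the whole polytope. -/
theorem polytope_eq_convexHull : L.polytope = convexHull ℝ (Set.range F.pos) := by
  have hconv : Convex ℝ L.polytope := by
    have : L.polytope = ⋂ i, {x | L.normal i ⬝ᵥ x ≤ L.bound i} := by
      ext; simp [polytope]
    rw [this]
    refine convex_iInter fun i => convex_halfSpace_le (f := fun x => L.normal i ⬝ᵥ x) ?_ _
    exact ⟨fun x y => dotProduct_add _ _ _, fun c x => dotProduct_smul _ _ _⟩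
  apply Set.Subset.antisymm
  · intro p hp
    by_contra hn
    obtain ⟨f, u, hf, hu⟩ := geometric_hahn_banach_closed_point (convex_convexHull ℝ _)
      ((Set.finite_range F.pos).isClosed_convexHull (𝕜 := ℝ)) hn
    have hfd : ∀ y, f y = (fun i => f (Pi.single i 1)) ⬝ᵥ y := by
      intro y
      conv_lhs => rw [← Finset.univ_sum_single y]
      rw [map_sum, dotProduct]
      refine Finset.sum_congr rfl fun i _ => ?_
      rw [show Pi.single i (y i) = y i • (Pi.single i 1 : Fin 3 → ℝ) by
        rw [← Pi.single_smul, smul_eq_mul, mul_one], map_smul, smul_eq_mul, mul_comm]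
    obtain ⟨x, hx⟩ := F.exists_forall_dotProduct_le fun i => f (Pi.single i 1)
    have h1 := hx p hp
    rw [← hfd, ← hfd] at h1
    have h2 := hf (F.pos x) (subset_convexHull ℝ _ ⟨x, rfl⟩)
    linarith
  · refine convexHull_min ?_ hconv
    rintro _ ⟨x, rfl⟩
    exact F.mem_polytope x

theorem vertices_eq : L.vertices = Set.range F.pos := by
  apply Set.Subset.antisymm
  · rw [vertices, F.polytope_eq_convexHull]
    exact extremePoints_convexHull_subset
  · rintro _ ⟨x, rfl⟩
    refine ⟨F.mem_polytope x, fun p hp q hq hpq => ?_⟩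
    refine F.ext_of_normal x fun j => ?_
    obtain ⟨a, b, ha, hb, hab, hx⟩ := hpq
    have h1 := F.tight x j
    rw [← hx, dotProduct_add, dotProduct_smul, dotProduct_smul, smul_eq_mul, smul_eq_mul] at h1
    rw [F.tight]
    have hp' := hp (F.t x j)
    have hq' := hq (F.t x j)
    have hb' : b = 1 - a := by linarith
    subst hb'
    by_contra hne
    have hlt := lt_of_le_of_ne hp' hne
    nlinarith

theorem mem_vertices (x : V) : F.pos x ∈ L.vertices := by
  rw [F.vertices_eq]; exact ⟨x, rfl⟩

variable {F} in
theorem _root_.LP3.Exchange.adj {x y : V} {j : Fin 3} (h : Exchange F.t x j y) :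
    L.Adj (F.pos x) (F.pos y) := by
  refine ⟨F.mem_vertices x, F.mem_vertices y, (h.pos_ne).symm, fun _ => ?_⟩
  -- The sum of the two normals kept along the edge attains its maximum over the polytope exactly on
  -- this edge.
  let c : Fin 3 → ℝ := ∑ k ∈ Finset.univ.erase j, L.normal (F.t x k)
  let f : StrongDual ℝ (Fin 3 → ℝ) := LinearMap.toContinuousLinearMap
    { toFun := fun p => c ⬝ᵥ p
      map_add' := fun y z => dotProduct_add _ _ _
      map_smul' := fun c y => dotProduct_smul _ _ _ }
  have hf : ∀ p, f p = ∑ k ∈ Finset.univ.erase j, L.normal (F.t x k) ⬝ᵥ p := fun p =>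
    show c ⬝ᵥ p = _ from sum_dotProduct _ _ _
  have hle : ∀ p ∈ L.polytope, f p ≤ f (F.pos x) := by
    intro p hp
    rw [hf, hf]
    refine Finset.sum_le_sum fun k _ => ?_
    rw [F.tight]
    exact hp _
  have hset : ∀ p ∈ L.polytope, f (F.pos x) ≤ f p →
      ∀ k, k ≠ j → L.normal (F.t x k) ⬝ᵥ p = L.bound (F.t x k) := by
    intro p hp hfp k hk
    rw [hf, hf] at hfp
    by_contra hne
    have : ∑ k ∈ Finset.univ.erase j, L.normal (F.t x k) ⬝ᵥ p <
        ∑ k ∈ Finset.univ.erase j, L.normal (F.t x k) ⬝ᵥ F.pos x := by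
      refine Finset.sum_lt_sum (fun k _ => ?_) ⟨k, by simp [hk], ?_⟩
      · rw [F.tight]; exact hp _
      · rw [F.tight]; exact lt_of_le_of_ne (hp _) hne
    linarith
  refine ⟨f, ?_⟩
  ext p
  constructor
  · rintro ⟨a, b, ha, hb, hab, rfl⟩
    have hconv : a • F.pos x + b • F.pos y ∈ L.polytope := by
      intro i
      rw [dotProduct_add, dotProduct_smul, dotProduct_smul, smul_eq_mul, smul_eq_mul]
      have h1 := F.mem_polytope x i
      have h2 := F.mem_polytope y i
      calc _ ≤ a * L.bound i + b * L.bound i := by gcongr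
        _ = _ := by rw [← add_mul, hab, one_mul]
    refine ⟨hconv, fun q hq => (hle q hq).trans (le_of_eq ?_)⟩
    have hxy : f (F.pos y) = f (F.pos x) := by
      rw [hf, hf]
      refine Finset.sum_congr rfl fun k hk => ?_
      rw [F.tight, h.tight_eq (by simpa using hk)]
    rw [map_add, map_smul, map_smul, hxy, ← add_smul, hab, one_smul]
  · rintro ⟨hp, hmax⟩
    have hk := hset p hp (hmax _ (F.mem_polytope x))
    set s := F.coord x p j / F.coord x (F.pos y) j with hs
    have hy0 : 0 < F.coord x (F.pos y) j :=
      div_pos (by linarith [h.slack_lt]) (by linarith [F.normal_dir_self x j])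
    have hps : p = F.pos x + s • (F.pos y - F.pos x) := by
      refine F.ext_of_normal x fun k => ?_
      rw [dotProduct_add, dotProduct_smul, dotProduct_sub, F.tight, smul_eq_mul]
      by_cases hkj : k = j
      · subst hkj
        have h3 := (F.normal_dir_self x k).ne
        have h4 : L.bound (F.t x k) - L.normal (F.t x k) ⬝ᵥ F.pos y ≠ 0 := by
          have := h.slack_lt
          intro h5
          linarith
        rw [hs, coord, coord, div_div_div_cancel_right₀ (neg_ne_zero.2 h3)]
        field_simp
        ring
      · rw [hk k hkj, h.tight_eq hkj]
        ring
    have hs0 : 0 ≤ s := div_nonneg (F.coord_nonneg x hp j) hy0.le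
    -- The edge ends at `y`, because some constraint tight at `y` is slack at `x`.
    have hs1 : s ≤ 1 := by
      obtain ⟨l, hl⟩ := h.exists_slack
      have h1 := hp (F.t y l)
      rw [hps, dotProduct_add, dotProduct_smul, dotProduct_sub, F.tight y l, smul_eq_mul] at h1
      nlinarith
    rw [hps]
    exact ⟨1 - s, s, by linarith, hs0, by ring, by module⟩

/-- For the converse, a functional exposing the segment is constant on it and does not increase
along edges at `x`. Every edge direction that occurs in `pos y - pos x` must then have value zero,
so the corresponding neighbour lies in the segment; being extreme and different from `x`, it is `y`.
-/
theorem adj_iff {x y : V} : L.Adj (F.pos x) (F.pos y) ↔ ∃ j, Exchange F.t x j y := by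
  refine ⟨fun h => ?_, fun ⟨j, hj⟩ => hj.adj⟩
  obtain ⟨-, -, hne, hexp⟩ := h
  obtain ⟨f, hf⟩ := hexp ⟨_, left_mem_segment ℝ _ _⟩
  have hx : F.pos x ∈ segment ℝ (F.pos x) (F.pos y) := left_mem_segment ℝ _ _
  have hy : F.pos y ∈ segment ℝ (F.pos x) (F.pos y) := right_mem_segment ℝ _ _
  rw [hf] at hx hy
  have hd : ∀ j, f (F.dir x j) ≤ 0 := fun j => by
    rw [dir, map_sub]
    linarith [hx.2 _ (F.mem_polytope (F.nb x j))]
  have hxy : f (F.pos y) = f (F.pos x) := le_antisymm (hx.2 _ hy.1) (hy.2 _ hx.1)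
  have hsum := congrArg f (F.eq_pos_add_sum x (F.pos y))
  rw [map_add, map_sum, hxy, left_eq_add] at hsum
  have hterm : ∀ j, f (F.coord x (F.pos y) j • F.dir x j) = 0 := by
    have := (Finset.sum_eq_zero_iff_of_nonpos fun j _ => ?_).1 hsum
    · exact fun j => this j (Finset.mem_univ j)
    · rw [map_smul, smul_eq_mul]
      exact mul_nonpos_of_nonneg_of_nonpos (F.coord_nonneg x hy.1 j) (hd j)
  obtain ⟨j, hj⟩ : ∃ j, F.coord x (F.pos y) j ≠ 0 := by
    by_contra! h0
    have := F.eq_pos_add_sum x (F.pos y)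
    simp only [h0, zero_smul, Finset.sum_const_zero, add_zero] at this
    exact hne this.symm
  have hfj : f (F.dir x j) = 0 := by
    have := hterm j
    rw [map_smul, smul_eq_mul] at this
    exact (mul_eq_zero.1 this).resolve_left hj
  have hmem : F.pos (F.nb x j) ∈ segment ℝ (F.pos x) (F.pos y) := by
    rw [hf]
    refine ⟨F.mem_polytope _, fun q hq => (hx.2 q hq).trans ?_⟩
    rw [dir, map_sub, sub_eq_zero] at hfj
    exact hfj.ge
  have hext := F.mem_vertices (F.nb x j)
  rw [vertices, mem_extremePoints_iff_forall_segment] at hext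
  have hnb : F.nb x j = y := by
    rcases hext.2 _ (F.mem_polytope x) _ (F.mem_polytope y) hmem with h | h
    · exact absurd h.symm (F.nb_exchange x j).pos_ne
    · exact (F.pos_injective h).symm
  exact ⟨j, hnb ▸ F.nb_exchange x j⟩

/-- The improving neighbours in terms of the frame. -/
theorem improving_eq (x : V) : L.improving (F.pos x) =
    F.pos '' {y | (∃ j, Exchange F.t x j y) ∧ L.value (F.pos y) < L.value (F.pos x)} := by
  ext w
  constructor
  · rintro ⟨h1, h2⟩
    have hw := h1.2.1
    rw [F.vertices_eq] at hw
    obtain ⟨y, rfl⟩ := hw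
    exact ⟨y, ⟨F.adj_iff.1 h1, h2⟩, rfl⟩
  · rintro ⟨y, ⟨h1, h2⟩, rfl⟩
    exact ⟨F.adj_iff.2 h1, h2⟩

end Finite

theorem isSimpleGeneric (F : Frame L V) [Finite V] [Nonempty V] : L.IsSimpleGeneric where
  bounded := by
    rw [F.polytope_eq_convexHull, isBounded_convexHull]
    exact (Set.finite_range F.pos).isBounded
  fullDim := F.interior_nonempty
  facet_dim := F.finrank_facet
  facet_injective := by
    intro i i' h
    by_contra hne
    obtain ⟨x, j, rfl⟩ := F.covers i
    obtain ⟨j', rfl⟩ : ∃ j', F.t x j' = i' := by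
      rw [← F.mem_facet_iff, ← h, F.mem_facet_iff]; exact ⟨j, rfl⟩
    have hjj : j ≠ j' := fun h => hne (h ▸ rfl)
    -- Moving from a common vertex along the edge that leaves one constraint but keeps the other
    -- separates the two facets.
    have h1 := (F.nb_exchange x j').1 j hjj
    rw [← F.mem_facet_iff, h, F.mem_facet_iff] at h1
    obtain ⟨l, hl⟩ := h1
    exact (F.nb_exchange x j').2 l hl
  simple := by
    intro v hv
    rw [F.vertices_eq] at hv
    obtain ⟨x, rfl⟩ := hv
    have : {i | F.pos x ∈ L.facet i} = Set.range (F.t x) := by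
      ext i; exact F.mem_facet_iff x i
    rw [this, Set.ncard_eq_toFinset_card', Set.toFinset_range,
      Finset.card_image_of_injective _ (F.t_injective x), Finset.card_univ, Fintype.card_fin]
  generic := by
    rw [F.vertices_eq]
    rintro _ ⟨x, rfl⟩ _ ⟨y, rfl⟩ h
    rw [F.value_injective h]

end Frame
end LP3

/-! ### Replacing a vertex by a small gadget -/

namespace LP3

theorem fin_three_exists_two : ∀ j : Fin 3, ∃ k₁ k₂ : Fin 3, k₁ ≠ j ∧ k₂ ≠ j ∧ k₁ ≠ k₂ ∧
    ∀ k, k ≠ j → k = k₁ ∨ k = k₂ := by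
  decide

theorem fin_three_exists_third : ∀ {i₁ i₂ : Fin 3}, i₁ ≠ i₂ →
    ∃ a : Fin 3, i₁ ≠ a ∧ i₂ ≠ a ∧ ∀ i, i ≠ a → i = i₁ ∨ i = i₂ := by
  decide

/-- A polyhedron in the nonnegative orthant, given by `m` constraints `β k ≤ g k ⬝ᵥ y`, with an
objective function `c`, listed by its `r` vertices `y w` and the triples of tight constraints.
The vertices are ordered by their objective value. -/
structure Gadget (m r : ℕ) where
  g : Fin m → Fin 3 → ℤ
  β : Fin m → ℤ
  c : Fin 3 → ℤ
  y : Fin r → Fin 3 → ℤ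
  t : Fin r → Fin 3 → Fin 3 ⊕ Fin m

namespace Gadget

variable {m r : ℕ}

/-- The vertex `w` lies on the unbounded edge in direction `a`, which is obtained by dropping its
`j`-th tight constraint. -/
structure Outer (G : Gadget m r) (w : Fin r) (j a : Fin 3) : Prop where
  keep : ∀ k, k ≠ j → ∃ i, i ≠ a ∧ G.t w k = Sum.inl i
  drop : ∃ k, G.t w j = Sum.inr k

instance (G : Gadget m r) (w : Fin r) (j a : Fin 3) : Decidable (G.Outer w j a) :=
  decidable_of_iff ((∀ k, k ≠ j → ∃ i, i ≠ a ∧ G.t w k = Sum.inl i) ∧ ∃ k, G.t w j = Sum.inr k)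
    ⟨fun h => ⟨h.1, h.2⟩, fun h => ⟨h.1, h.2⟩⟩

/-- The data of a gadget describe a simple polyhedron with its vertices. -/
structure Valid (G : Gadget m r) : Prop where
  g_pos : ∀ k i, 0 < G.g k i
  β_pos : ∀ k, 0 < G.β k
  c_zero_pos : 0 < G.c 0
  c_one_pos : 0 < G.c 1
  c_two_neg : G.c 2 < 0
  t_injective : ∀ w, Function.Injective (G.t w)
  axis_tight : ∀ w i, (∃ j, G.t w j = Sum.inl i) → G.y w i = 0
  axis_slack : ∀ w i, (¬ ∃ j, G.t w j = Sum.inl i) → 0 < G.y w i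
  facet_tight : ∀ w k, (∃ j, G.t w j = Sum.inr k) → ∑ i, G.g k i * G.y w i = G.β k
  facet_slack : ∀ w k, (¬ ∃ j, G.t w j = Sum.inr k) → G.β k < ∑ i, G.g k i * G.y w i
  exists_exchange : ∀ w j, (∃ w', Exchange G.t w j w') ∨ ∃ a, G.Outer w j a
  exists_entry : ∀ a, ∃ w, ∀ i, i ≠ a → ∃ j, G.t w j = Sum.inl i
  covers : ∀ k, ∃ w j, G.t w j = Sum.inr k
  exists_facet : ∀ w, ∃ j k, G.t w j = Sum.inr k
  value_strictMono : StrictMono fun w => ∑ i, G.c i * G.y w i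

/-- `f w` and `h w` are the improving neighbours of `w`, where `none` stands for the end of the
improving unbounded edge; `1024` times the expected number of steps until this edge has been
traversed is `e w`. -/
structure Steps (G : Gadget m r) (f h : Fin r → Option (Fin r)) (e : Fin r → ℕ) : Prop where
  some_iff : ∀ w w', (some w' = f w ∨ some w' = h w) ↔ w' < w ∧ ∃ j, Exchange G.t w j w'
  none_iff : ∀ w, (none = f w ∨ none = h w) ↔ ∃ j, G.Outer w j 2
  two_mul : ∀ w, 2 * e w = 2048 + (f w).elim 0 e + (h w).elim 0 e

end Gadget

variable {n m r : ℕ} {L : LP3 n} {V : Type}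

namespace Frame

variable {F : Frame L V}

/-- Both points lie on the same ray from `x`, and `z` cannot be beyond `y`, where a constraint that
is slack at `x` becomes tight. By symmetry, exchanges are unique. -/
theorem _root_.LP3.Exchange.slack_le {x y z : V} {j : Fin 3} (hy : Exchange F.t x j y)
    (hz : Exchange F.t x j z) :
    L.bound (F.t x j) - L.normal (F.t x j) ⬝ᵥ F.pos z ≤
      L.bound (F.t x j) - L.normal (F.t x j) ⬝ᵥ F.pos y := by
  set sy := L.bound (F.t x j) - L.normal (F.t x j) ⬝ᵥ F.pos y with hsy
  set sz := L.bound (F.t x j) - L.normal (F.t x j) ⬝ᵥ F.pos z with hsz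
  have h : sy • (F.pos z - F.pos x) = sz • (F.pos y - F.pos x) := by
    refine F.ext_of_normal x fun k => ?_
    rw [dotProduct_smul, dotProduct_smul, dotProduct_sub, dotProduct_sub, F.tight, smul_eq_mul,
      smul_eq_mul]
    by_cases hk : k = j
    · subst hk
      rw [hsy, hsz]
      ring
    · rw [hy.tight_eq hk, hz.tight_eq hk]
      ring
  obtain ⟨l, hl⟩ := hy.exists_slack
  have h1 := congrArg (fun p => L.normal (F.t y l) ⬝ᵥ p) h
  simp only [dotProduct_smul, dotProduct_sub, F.tight y l, smul_eq_mul] at h1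
  have h2 := F.mem_polytope z (F.t y l)
  have h3 : 0 < sy := by linarith [hy.slack_lt]
  nlinarith

theorem _root_.LP3.Exchange.unique {x y z : V} {j : Fin 3} (hy : Exchange F.t x j y)
    (hz : Exchange F.t x j z) : y = z := by
  refine F.pos_injective (F.ext_of_normal x fun k => ?_)
  by_cases hk : k = j
  · subst hk
    linarith [hy.slack_le hz, hz.slack_le hy]
  · rw [hy.tight_eq hk, hz.tight_eq hk]

variable (F)

theorem value_add_sum (p : Fin 3 → ℝ) (x : V) (a : Fin 3 → ℝ) :
    L.value (p + ∑ j, a j • F.dir x j) = L.value p + ∑ j, a j * L.value (F.dir x j) := by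
  simp only [value, dotProduct_add, dotProduct_sum, dotProduct_smul, smul_eq_mul]

variable (v : V) (G : Gadget m r) (ε : ℝ)

/-- The factors by which the edge directions at `v` have to be scaled such that the objective
function becomes the one of the gadget. -/
noncomputable def scale (j : Fin 3) : ℝ := G.c j / L.value (F.dir v j)

/-- The slack of the `j`-th tight constraint at `v` at the end of the scaled edge direction. -/
noncomputable def slackScale (j : Fin 3) : ℝ :=
  F.scale v G j * -(L.normal (F.t v j) ⬝ᵥ F.dir v j)

/-- The linear program in which the vertex `v` is replaced by a copy of `G`, scaled by `ε`. -/
noncomputable def insertLP : LP3 (n + m) where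
  normal := Fin.append L.normal fun k =>
    ∑ i, (G.g k i / F.slackScale v G i) • L.normal (F.t v i)
  bound := Fin.append L.bound fun k =>
    ∑ i, (G.g k i / F.slackScale v G i) * L.bound (F.t v i) - ε * G.β k
  objective := L.objective

/-- The vertices of the scaled copy of `G`. -/
noncomputable def insertVertex (w : Fin r) : Fin 3 → ℝ :=
  F.pos v + ∑ j, (ε * (F.scale v G j * G.y w j)) • F.dir v j

/-- The constraints of the gadget among those of the linear program. -/
def insertIndex : Fin 3 ⊕ Fin m → Fin (n + m) :=
  Sum.elim (Fin.castAdd m ∘ F.t v) (Fin.natAdd n)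

/-- The tight constraints of the vertices after the insertion of a gadget. -/
def insertTight : {x // x ≠ v} ⊕ Fin r → Fin 3 → Fin (n + m) :=
  Sum.elim (fun x j => Fin.castAdd m (F.t x j)) (fun w j => F.insertIndex v (G.t w j))

/-- The vertices after the insertion of a gadget. -/
noncomputable def insertPos : {x // x ≠ v} ⊕ Fin r → Fin 3 → ℝ :=
  Sum.elim (fun x => F.pos x) (F.insertVertex v G ε)

/-- The vertex `v` has the same improving edges as the gadget. -/
structure Compatible : Prop where
  valid : G.Valid
  zero_lt : L.value (F.pos v) < L.value (F.pos (F.nb v 0))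
  one_lt : L.value (F.pos v) < L.value (F.pos (F.nb v 1))
  two_lt : L.value (F.pos (F.nb v 2)) < L.value (F.pos v)

/-- The gadget is so small that it does not interfere with the other vertices. -/
structure Small : Prop where
  pos : 0 < ε
  slack : ∀ w i, (∀ j, F.t v j ≠ i) → L.normal i ⬝ᵥ F.insertVertex v G ε w < L.bound i
  far : ∀ x, x ≠ v → ∀ k, ε * G.β k <
    ∑ i, G.g k i / F.slackScale v G i * (L.bound (F.t v i) - L.normal (F.t v i) ⬝ᵥ F.pos x)
  above : ∀ x, L.value (F.pos v) < L.value (F.pos x) → ∀ w,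
    L.value (F.insertVertex v G ε w) < L.value (F.pos x)
  below : ∀ x, L.value (F.pos x) < L.value (F.pos v) → ∀ w,
    L.value (F.pos x) < L.value (F.insertVertex v G ε w)

variable {F v G ε}

theorem insertIndex_injective : Function.Injective (F.insertIndex v : Fin 3 ⊕ Fin m → _) := by
  refine Function.Injective.sumElim ((Fin.castAdd_injective n m).comp (F.t_injective v))
    (Fin.natAdd_injective m n) fun a b h => ?_
  have := congrArg Fin.val h
  simp at this
  omega

theorem value_dir (x : V) (j : Fin 3) :
    L.value (F.dir x j) = L.value (F.pos (F.nb x j)) - L.value (F.pos x) := dotProduct_sub _ _ _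

theorem Compatible.scale_pos (h : Compatible F v G) (j : Fin 3) : 0 < F.scale v G j := by
  have h0 := h.zero_lt
  have h1 := h.one_lt
  have h2 := h.two_lt
  rw [scale, value_dir]
  rcases (by fin_cases j <;> simp : j = 0 ∨ j = 1 ∨ j = 2) with rfl | rfl | rfl
  · exact div_pos (by exact_mod_cast h.valid.c_zero_pos) (by linarith)
  · exact div_pos (by exact_mod_cast h.valid.c_one_pos) (by linarith)
  · exact div_pos_of_neg_of_neg (by exact_mod_cast h.valid.c_two_neg) (by linarith)

theorem Compatible.slackScale_pos (h : Compatible F v G) (j : Fin 3) :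
    0 < F.slackScale v G j :=
  mul_pos (h.scale_pos j) (by linarith [F.normal_dir_self v j])

theorem Compatible.scale_mul_value (h : Compatible F v G) (j : Fin 3) :
    F.scale v G j * L.value (F.dir v j) = G.c j := by
  refine div_mul_cancel₀ _ ?_
  intro h0
  have := h.scale_pos j
  rw [scale, h0, div_zero] at this
  exact lt_irrefl _ this

theorem Compatible.value_insertVertex (h : Compatible F v G) (w : Fin r) :
    L.value (F.insertVertex v G ε w) = L.value (F.pos v) + ε * (∑ i, G.c i * G.y w i : ℤ) := by
  rw [insertVertex, value_add_sum]
  push_cast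
  rw [Finset.mul_sum]
  congr 1
  refine Finset.sum_congr rfl fun j _ => ?_
  rw [← h.scale_mul_value]
  ring

theorem slack_insertVertex (w : Fin r) (j : Fin 3) :
    L.bound (F.t v j) - L.normal (F.t v j) ⬝ᵥ F.insertVertex v G ε w =
      ε * (F.slackScale v G j * G.y w j) := by
  rw [insertVertex, dotProduct_add, F.normal_sum_dir, F.tight, slackScale]
  ring

theorem insertLP_slack (k : Fin m) (p : Fin 3 → ℝ) :
    (F.insertLP v G ε).bound (Fin.natAdd n k) - (F.insertLP v G ε).normal (Fin.natAdd n k) ⬝ᵥ p =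
      ∑ i, G.g k i / F.slackScale v G i * (L.bound (F.t v i) - L.normal (F.t v i) ⬝ᵥ p) -
        ε * G.β k := by
  simp only [insertLP, Fin.append_right, sum_dotProduct, smul_dotProduct, smul_eq_mul, mul_sub,
    Finset.sum_sub_distrib]
  ring

theorem insertLP_normal_castAdd (i : Fin n) :
    (F.insertLP v G ε).normal (Fin.castAdd m i) = L.normal i := by
  simp only [insertLP, Fin.append_left]

theorem insertLP_bound_castAdd (i : Fin n) :
    (F.insertLP v G ε).bound (Fin.castAdd m i) = L.bound i := by
  simp only [insertLP, Fin.append_left]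

theorem Compatible.insertLP_slack_insertVertex (h : Compatible F v G) (k : Fin m) (w : Fin r) :
    (F.insertLP v G ε).bound (Fin.natAdd n k) -
        (F.insertLP v G ε).normal (Fin.natAdd n k) ⬝ᵥ F.insertVertex v G ε w =
      ε * ((∑ i, G.g k i * G.y w i - G.β k : ℤ) : ℝ) := by
  rw [insertLP_slack]
  push_cast
  rw [mul_sub, Finset.mul_sum]
  congr 1
  refine Finset.sum_congr rfl fun i _ => ?_
  rw [slack_insertVertex]
  have := (h.slackScale_pos i).ne'
  field_simp

/-- All coefficients are positive, and the three slacks at `v` vanish together only at `v`. Hence a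
new constraint cuts off nothing but a neighbourhood of `v` when `ε` is small. -/
theorem Compatible.far_sum_pos (h : Compatible F v G) {x : V} (hx : x ≠ v) (k : Fin m) :
    0 < ∑ i, G.g k i / F.slackScale v G i *
      (L.bound (F.t v i) - L.normal (F.t v i) ⬝ᵥ F.pos x) := by
  have hg : ∀ i, 0 < G.g k i / F.slackScale v G i := fun i =>
    div_pos (by exact_mod_cast h.valid.g_pos k i) (h.slackScale_pos i)
  have hs : ∀ i, 0 ≤ L.bound (F.t v i) - L.normal (F.t v i) ⬝ᵥ F.pos x := fun i => by
    linarith [F.mem_polytope x (F.t v i)]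
  refine Finset.sum_pos' (fun i _ => mul_nonneg (hg i).le (hs i)) ?_
  by_contra! h0
  refine hx (F.pos_injective (F.ext_of_normal v fun i => ?_))
  have h1 := h0 i (Finset.mem_univ i)
  have h2 := nonpos_of_mul_nonpos_right h1 (hg i)
  rw [F.tight]
  linarith [hs i]

-- Apart from positivity of `ε`, the requirements are finitely many strict inequalities, continuous
-- in `ε` and true at `ε = 0`, where the copy collapses to `v`.
open Filter Topology in
theorem Compatible.exists_small [Finite V] (h : Compatible F v G) :
    ∃ ε, Small F v G ε := by
  have hcont : ∀ w, Continuous fun ε => F.insertVertex v G ε w := fun w => by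
    unfold insertVertex
    fun_prop
  have hzero : ∀ w, F.insertVertex v G 0 w = F.pos v := fun w => by
    simp [insertVertex]
  have hval : ∀ w, Continuous fun ε => L.value (F.insertVertex v G ε w) := fun w =>
    continuous_const.dotProduct (hcont w)
  have h1 : ∀ᶠ ε in 𝓝 (0 : ℝ), ∀ w i, (∀ j, F.t v j ≠ i) →
      L.normal i ⬝ᵥ F.insertVertex v G ε w < L.bound i := by
    rw [eventually_all]
    intro w
    rw [eventually_all]
    intro i
    by_cases hi : ∀ j, F.t v j ≠ i
    · have hc : Continuous fun ε => L.normal i ⬝ᵥ F.insertVertex v G ε w :=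
        continuous_const.dotProduct (hcont w)
      have := (hc.tendsto 0).eventually_lt_const (u := L.bound i)
        (by rw [hzero]; exact F.slack v i hi)
      filter_upwards [this] with ε hε _ using hε
    · filter_upwards with ε h using absurd h hi
  have h2 : ∀ᶠ ε in 𝓝 (0 : ℝ), ∀ x, x ≠ v → ∀ k, ε * G.β k <
      ∑ i, G.g k i / F.slackScale v G i *
        (L.bound (F.t v i) - L.normal (F.t v i) ⬝ᵥ F.pos x) := by
    rw [eventually_all]
    intro x
    by_cases hx : x ≠ v
    · have : ∀ k, ∀ᶠ ε in 𝓝 (0 : ℝ), ε * G.β k <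
          ∑ i, G.g k i / F.slackScale v G i *
            (L.bound (F.t v i) - L.normal (F.t v i) ⬝ᵥ F.pos x) := fun k =>
        ((continuous_id.mul continuous_const).tendsto (0 : ℝ)).eventually_lt_const
          (by simpa using h.far_sum_pos hx k)
      rw [← eventually_all] at this
      filter_upwards [this] with ε hε _ using hε
    · filter_upwards with ε h using absurd h hx
  have h3 : ∀ᶠ ε in 𝓝 (0 : ℝ), ∀ x, L.value (F.pos v) < L.value (F.pos x) → ∀ w,
      L.value (F.insertVertex v G ε w) < L.value (F.pos x) := by
    rw [eventually_all]
    intro x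
    by_cases hx : L.value (F.pos v) < L.value (F.pos x)
    · have : ∀ w, ∀ᶠ ε in 𝓝 (0 : ℝ), L.value (F.insertVertex v G ε w) < L.value (F.pos x) :=
        fun w => ((hval w).tendsto 0).eventually_lt_const (by rwa [hzero])
      rw [← eventually_all] at this
      filter_upwards [this] with ε hε _ using hε
    · filter_upwards with ε h using absurd h hx
  have h4 : ∀ᶠ ε in 𝓝 (0 : ℝ), ∀ x, L.value (F.pos x) < L.value (F.pos v) → ∀ w,
      L.value (F.pos x) < L.value (F.insertVertex v G ε w) := by
    rw [eventually_all]
    intro x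
    by_cases hx : L.value (F.pos x) < L.value (F.pos v)
    · have : ∀ w, ∀ᶠ ε in 𝓝 (0 : ℝ), L.value (F.pos x) < L.value (F.insertVertex v G ε w) :=
        fun w => ((hval w).tendsto 0).eventually_const_lt (by rwa [hzero])
      rw [← eventually_all] at this
      filter_upwards [this] with ε hε _ using hε
    · filter_upwards with ε h using absurd h hx
  have h5 : ∀ᶠ ε in 𝓝[>] (0 : ℝ), Small F v G ε := by
    filter_upwards [self_mem_nhdsWithin, nhdsWithin_le_nhds h1, nhdsWithin_le_nhds h2,
      nhdsWithin_le_nhds h3, nhdsWithin_le_nhds h4] with ε h0 h1 h2 h3 h4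
    exact ⟨h0, h1, h2, h3, h4⟩
  exact h5.exists

/-! ### The edges after the insertion -/

theorem exchange_inl_inl {x y : {x // x ≠ v}} {j : Fin 3} :
    Exchange (F.insertTight v G) (Sum.inl x) j (Sum.inl y) ↔ Exchange F.t x.1 j y.1 := by
  simp only [LP3.exchange_iff, insertTight, Sum.elim_inl, (Fin.castAdd_injective n m).eq_iff,
    (Fin.castAdd_injective n m).ne_iff]

theorem exchange_inr_inr {w w' : Fin r} {j : Fin 3} :
    Exchange (F.insertTight v G) (Sum.inr w) j (Sum.inr w') ↔ Exchange G.t w j w' := by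
  simp only [LP3.exchange_iff, insertTight, Sum.elim_inr, insertIndex_injective.eq_iff,
    insertIndex_injective.ne_iff]

theorem insertIndex_ne_natAdd (x : V) (j : Fin 3) (k : Fin m) :
    Fin.castAdd m (F.t x j) ≠ Fin.natAdd n k := by
  intro h
  have := congrArg Fin.val h
  simp at this
  omega

theorem exchange_inr_inl_of_outer {w : Fin r} {j a : Fin 3} (hw : G.Outer w j a)
    {x : {x // x ≠ v}} (hx : Exchange F.t v a x.1) :
    Exchange (F.insertTight v G) (Sum.inr w) j (Sum.inl x) := by
  constructor
  · intro k hk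
    obtain ⟨i, hi, hwk⟩ := hw.keep k hk
    obtain ⟨l, hl⟩ := hx.keep i hi
    exact ⟨l, by simp [insertTight, hwk, insertIndex, hl]⟩
  · intro l
    obtain ⟨k, hk⟩ := hw.drop
    simpa [insertTight, hk, insertIndex] using insertIndex_ne_natAdd x.1 l k

theorem outer_of_exchange_inr_inl (hG : G.Valid) {w : Fin r} {j : Fin 3} {x : {x // x ≠ v}}
    (hx : Exchange (F.insertTight v G) (Sum.inr w) j (Sum.inl x)) :
    ∃ a, G.Outer w j a ∧ Exchange F.t v a x.1 := by
  -- An old vertex carries no gadget constraint in its triple, so both kept constraints are among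
  -- those of `v`. The dropped one is then a gadget facet, since every gadget vertex lies on one.
  have hkeep : ∀ k, k ≠ j → ∃ i l, G.t w k = Sum.inl i ∧ F.t x.1 l = F.t v i := by
    intro k hk
    obtain ⟨l, hl⟩ := hx.keep k hk
    simp only [insertTight, Sum.elim_inl, Sum.elim_inr] at hl
    rcases hwk : G.t w k with i | i
    · rw [hwk] at hl
      exact ⟨i, l, rfl, (Fin.castAdd_injective n m) hl⟩
    · rw [hwk] at hl
      exact absurd hl (insertIndex_ne_natAdd x.1 l i)
  obtain ⟨j', k₀, hk₀⟩ := hG.exists_facet w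
  obtain rfl : j' = j := by
    by_contra hne
    obtain ⟨i, -, hi, -⟩ := hkeep j' hne
    rw [hi] at hk₀
    exact Sum.inl_ne_inr hk₀
  obtain ⟨k₁, k₂, h1, h2, h12, hk⟩ : ∃ k₁ k₂ : Fin 3, k₁ ≠ j' ∧ k₂ ≠ j' ∧ k₁ ≠ k₂ ∧
      ∀ k, k ≠ j' → k = k₁ ∨ k = k₂ := fin_three_exists_two j'
  obtain ⟨i₁, l₁, hi₁, hl₁⟩ := hkeep k₁ h1
  obtain ⟨i₂, l₂, hi₂, hl₂⟩ := hkeep k₂ h2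
  have hi12 : i₁ ≠ i₂ := fun h => h12 (hG.t_injective w (by rw [hi₁, hi₂, h]))
  obtain ⟨a, ha1, ha2, ha⟩ : ∃ a : Fin 3, i₁ ≠ a ∧ i₂ ≠ a ∧ ∀ i, i ≠ a → i = i₁ ∨ i = i₂ :=
    fin_three_exists_third hi12
  have hkept : ∀ i, i ≠ a → ∃ l, F.t x.1 l = F.t v i := by
    intro i hi
    rcases ha i hi with rfl | rfl
    exacts [⟨l₁, hl₁⟩, ⟨l₂, hl₂⟩]
  refine ⟨a, ⟨fun k hkj => ?_, k₀, hk₀⟩, hkept, fun l hl => x.2 ?_⟩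
  · rcases hk k hkj with rfl | rfl
    exacts [⟨i₁, ha1, hi₁⟩, ⟨i₂, ha2, hi₂⟩]
  -- If the third constraint of `v` were tight as well, the point would be `v` itself.
  · refine F.pos_injective (F.ext_of_normal v fun i => ?_)
    rw [F.tight, F.tight_iff]
    by_cases hi : i = a
    · exact ⟨l, hi ▸ hl⟩
    · exact hkept i hi

theorem exists_exchange_inl_inr (hG : G.Valid) {x : {x // x ≠ v}} {j : Fin 3}
    (hx : Exchange F.t x.1 j v) :
    ∃ w, Exchange (F.insertTight v G) (Sum.inl x) j (Sum.inr w) := by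
  obtain ⟨k₁, k₂, h1, h2, h12, hk⟩ := fin_three_exists_two j
  obtain ⟨i₁, hi₁⟩ := hx.keep k₁ h1
  obtain ⟨i₂, hi₂⟩ := hx.keep k₂ h2
  have hi12 : i₁ ≠ i₂ := fun h => h12 (F.t_injective x (by rw [← hi₁, ← hi₂, h]))
  obtain ⟨a, ha1, ha2, -⟩ := fin_three_exists_third hi12
  obtain ⟨w, hw⟩ := hG.exists_entry a
  refine ⟨w, fun k hkj => ?_, fun l => ?_⟩
  · obtain ⟨i, hi, hia⟩ : ∃ i, F.t v i = F.t x.1 k ∧ i ≠ a := by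
      rcases hk k hkj with rfl | rfl
      exacts [⟨i₁, hi₁, ha1⟩, ⟨i₂, hi₂, ha2⟩]
    obtain ⟨l, hl⟩ := hw i hia
    exact ⟨l, by simp [insertTight, hl, insertIndex, hi]⟩
  · rcases hl : G.t w l with i | k
    · simpa [insertTight, hl, insertIndex] using hx.drop i
    · simpa [insertTight, hl, insertIndex] using (insertIndex_ne_natAdd x.1 j k).symm

/-- The vertices of the linear program after the insertion of a gadget. -/
noncomputable def insertFrame (h : Compatible F v G) (hε : Small F v G ε) :
    Frame (F.insertLP v G ε) ({x // x ≠ v} ⊕ Fin r) where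
  pos := F.insertPos v G ε
  t := F.insertTight v G
  t_injective := by
    rintro (x | w)
    · exact (Fin.castAdd_injective n m).comp (F.t_injective x)
    · exact insertIndex_injective.comp (h.valid.t_injective w)
  tight := by
    rintro (x | w) j
    · simp only [insertTight, insertPos, Sum.elim_inl, insertLP_normal_castAdd,
        insertLP_bound_castAdd]
      exact F.tight x j
    · simp only [insertTight, insertPos, Sum.elim_inr]
      rcases hj : G.t w j with i | k
      · have h1 := F.slack_insertVertex (v := v) (G := G) (ε := ε) w i
        rw [h.valid.axis_tight w i ⟨j, hj⟩] at h1
        simp only [insertIndex, Sum.elim_inl, Function.comp_apply, insertLP_normal_castAdd,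
          insertLP_bound_castAdd]
        simp at h1
        linarith
      · have h1 := h.insertLP_slack_insertVertex (ε := ε) k w
        rw [h.valid.facet_tight w k ⟨j, hj⟩, sub_self, Int.cast_zero, mul_zero] at h1
        simp only [insertIndex, Sum.elim_inr]
        linarith
  slack := by
    intro z i
    refine Fin.addCases (fun i hi => ?_) (fun k hk => ?_) i
    · rw [insertLP_normal_castAdd, insertLP_bound_castAdd]
      rcases z with x | w
      · exact F.slack x i fun j hj => hi j (by simp [insertTight, hj])
      · by_cases hv : ∃ j, F.t v j = i
        · obtain ⟨a, rfl⟩ := hv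
          have h1 := F.slack_insertVertex (v := v) (G := G) (ε := ε) w a
          have h2 : 0 < G.y w a := h.valid.axis_slack w a fun ⟨j, hj⟩ =>
            hi j (by simp [insertTight, hj, insertIndex])
          have h3 : 0 < ε * (F.slackScale v G a * G.y w a) :=
            mul_pos hε.pos (mul_pos (h.slackScale_pos a) (by exact_mod_cast h2))
          simp only [insertPos, Sum.elim_inr]
          linarith
        · push Not at hv
          exact hε.slack w i hv
    · rcases z with x | w
      · have h1 := F.insertLP_slack (v := v) (G := G) (ε := ε) k (F.pos x)
        have h2 := hε.far x x.2 k
        simp only [insertPos, Sum.elim_inl]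
        linarith
      · have h1 := h.insertLP_slack_insertVertex (ε := ε) k w
        have h2 := h.valid.facet_slack w k fun ⟨j, hj⟩ =>
          hk j (by simp [insertTight, hj, insertIndex])
        have h3 : (0 : ℝ) < ε * ((∑ i, G.g k i * G.y w i - G.β k : ℤ) : ℝ) :=
          mul_pos hε.pos (by exact_mod_cast sub_pos.2 h2)
        simp only [insertPos, Sum.elim_inr]
        linarith
  exists_exchange := by
    rintro (x | w) j
    · obtain ⟨y, hy⟩ := F.exists_exchange x j
      by_cases hyv : y = v
      · subst hyv
        obtain ⟨w, hw⟩ := exists_exchange_inl_inr (v := y) (x := x) h.valid hy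
        exact ⟨Sum.inr w, hw⟩
      · exact ⟨Sum.inl ⟨y, hyv⟩, exchange_inl_inl.2 hy⟩
    · rcases h.valid.exists_exchange w j with ⟨w', hw'⟩ | ⟨a, ha⟩
      · exact ⟨Sum.inr w', exchange_inr_inr.2 hw'⟩
      · have hne : F.nb v a ≠ v := fun he => (F.nb_exchange v a).pos_ne (by rw [he])
        exact ⟨Sum.inl ⟨F.nb v a, hne⟩, exchange_inr_inl_of_outer ha (F.nb_exchange v a)⟩
  covers := by
    intro i
    refine Fin.addCases (fun i => ?_) (fun k => ?_) i
    · by_cases hv : ∃ a, F.t v a = i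
      · obtain ⟨a, rfl⟩ := hv
        -- Since `v` disappears, its constraint `a` needs another witness: the entry vertex of any
        -- direction other than `a` lies on it.
        obtain ⟨w, hw⟩ := h.valid.exists_entry (a + 1)
        obtain ⟨j, hj⟩ := hw a (by simp)
        exact ⟨Sum.inr w, j, by simp [insertTight, hj, insertIndex]⟩
      · obtain ⟨x, j, hj⟩ := F.covers i
        have hx : x ≠ v := fun he => hv ⟨j, he ▸ hj⟩
        exact ⟨Sum.inl ⟨x, hx⟩, j, by simp [insertTight, hj]⟩
    · obtain ⟨w, j, hj⟩ := h.valid.covers k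
      exact ⟨Sum.inr w, j, by simp [insertTight, hj, insertIndex]⟩
  value_injective := by
    have hne : ∀ (x : {x // x ≠ v}) w, L.value (F.pos x) ≠ L.value (F.insertVertex v G ε w) := by
      intro x w
      rcases lt_trichotomy (L.value (F.pos x)) (L.value (F.pos v)) with hlt | heq | hlt
      · exact (hε.below x hlt w).ne
      · exact absurd (F.value_injective heq) x.2
      · exact (hε.above x hlt w).ne'
    refine fun z z' hz => ?_
    have hz' : L.value (F.insertPos v G ε z) = L.value (F.insertPos v G ε z') := hz
    rcases z with x | w <;> rcases z' with x' | w'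
    · exact congrArg Sum.inl (Subtype.ext (F.value_injective hz'))
    · exact absurd hz' (hne x w')
    · exact absurd hz'.symm (hne x' w)
    · simp only [insertPos, Sum.elim_inr, h.value_insertVertex, add_right_inj] at hz'
      have h1 := mul_left_cancel₀ hε.pos.ne' hz'
      exact congrArg Sum.inr (h.valid.value_strictMono.injective (by exact_mod_cast h1))

/-! ### The random edge rule after the insertion -/

theorem insertFrame_pos_inl (h : Compatible F v G) (hε : Small F v G ε) (x : {x // x ≠ v}) :
    (insertFrame h hε).pos (Sum.inl x) = F.pos x := rfl

theorem insertFrame_pos_inr (h : Compatible F v G) (hε : Small F v G ε) (w : Fin r) :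
    (insertFrame h hε).pos (Sum.inr w) = F.insertVertex v G ε w := rfl

theorem insertVertex_lt_iff (h : Compatible F v G) (hε : Small F v G ε) {w w' : Fin r} :
    L.value (F.insertVertex v G ε w) < L.value (F.insertVertex v G ε w') ↔ w < w' := by
  rw [h.value_insertVertex, h.value_insertVertex, add_lt_add_iff_left,
    mul_lt_mul_iff_of_pos_left hε.pos, Int.cast_lt]
  exact h.valid.value_strictMono.lt_iff_lt

variable [Finite V]

theorem insertLP_improving_of_lt [Nonempty V] (h : Compatible F v G) (hε : Small F v G ε) {x : V}
    (hx : L.value (F.pos x) < L.value (F.pos v)) :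
    (F.insertLP v G ε).improving (F.pos x) = L.improving (F.pos x) := by
  have hxv : x ≠ v := by rintro rfl; exact lt_irrefl _ hx
  have : Nonempty ({x // x ≠ v} ⊕ Fin r) := ⟨Sum.inl ⟨x, hxv⟩⟩
  rw [← insertFrame_pos_inl h hε ⟨x, hxv⟩, improving_eq, insertFrame_pos_inl, improving_eq]
  ext p
  constructor
  · rintro ⟨y | w, ⟨⟨j, hj⟩, hlt⟩, rfl⟩
    · exact ⟨y, ⟨⟨j, exchange_inl_inl.1 hj⟩, hlt⟩, rfl⟩
    · exact absurd hlt (hε.below x hx w).not_gt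
  · rintro ⟨y, ⟨⟨j, hj⟩, hlt⟩, rfl⟩
    have hyv : y ≠ v := by rintro rfl; exact lt_asymm hx hlt
    exact ⟨Sum.inl ⟨y, hyv⟩, ⟨⟨j, exchange_inl_inl.2 hj⟩, hlt⟩, rfl⟩

/-- Induction on the objective value: the walk only descends, so it never meets the modified part.
-/
theorem insertLP_expectedSteps_of_lt [Nonempty V] (h : Compatible F v G) (hε : Small F v G ε)
    (x : V) (hx : L.value (F.pos x) < L.value (F.pos v)) :
    (F.insertLP v G ε).expectedSteps (F.pos x) = L.expectedSteps (F.pos x) := by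
  have hwf : WellFounded fun x y => L.value (F.pos x) < L.value (F.pos y) :=
    have : IsTrans V fun x y => L.value (F.pos x) < L.value (F.pos y) := ⟨fun _ _ _ => lt_trans⟩
    have : Std.Irrefl fun x y => L.value (F.pos x) < L.value (F.pos y) := ⟨fun _ => lt_irrefl _⟩
    Finite.wellFounded_of_trans_of_irrefl _
  induction x using hwf.induction with
  | _ x ih =>
    refine expectedSteps_congr (insertLP_improving_of_lt h hε hx) fun w hw => ?_
    rw [improving_eq] at hw
    obtain ⟨y, ⟨-, hlt⟩, rfl⟩ := hw
    exact ih y hlt (hlt.trans hx)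

theorem insertLP_improving_insertVertex [Nonempty V] (h : Compatible F v G) (hε : Small F v G ε)
    {f g : Fin r → Option (Fin r)} {e : Fin r → ℕ} (hs : G.Steps f g e) (w : Fin r) :
    (F.insertLP v G ε).improving (F.insertVertex v G ε w) =
      {(f w).elim (F.pos (F.nb v 2)) (F.insertVertex v G ε),
        (g w).elim (F.pos (F.nb v 2)) (F.insertVertex v G ε)} := by
  have hne : F.nb v 2 ≠ v := fun he => (F.nb_exchange v 2).pos_ne (by rw [he])
  have : Nonempty ({x // x ≠ v} ⊕ Fin r) := ⟨Sum.inl ⟨_, hne⟩⟩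
  have hset : ({(f w).elim (F.pos (F.nb v 2)) (F.insertVertex v G ε),
      (g w).elim (F.pos (F.nb v 2)) (F.insertVertex v G ε)} : Set (Fin 3 → ℝ)) =
      (fun o : Option (Fin r) => o.elim (F.pos (F.nb v 2)) (F.insertVertex v G ε)) ''
        {o | o = f w ∨ o = g w} := by
    rw [show {o | o = f w ∨ o = g w} = {f w, g w} from rfl, Set.image_pair]
  rw [hset, ← insertFrame_pos_inr h hε w, improving_eq, insertFrame_pos_inr]
  ext p
  constructor
  · rintro ⟨y | w', ⟨⟨j, hj⟩, hlt⟩, rfl⟩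
    · obtain ⟨a, ha, hya⟩ := outer_of_exchange_inr_inl h.valid hj
      have hy : F.nb v a = y := (F.nb_exchange v a).unique hya
      have hyv : L.value (F.pos (F.nb v a)) < L.value (F.pos v) := by
        by_contra hle
        have hlt' : L.value (F.pos v) < L.value (F.pos y) := by
          rw [← hy]
          refine lt_of_le_of_ne (not_lt.1 hle) fun he => ?_
          exact y.2 (hy.symm.trans (F.value_injective he.symm))
        exact lt_asymm hlt (hε.above y hlt' w)
      -- The unbounded edges in directions `0` and `1` lead to vertices above `v`, hence above the
      -- whole copy; only direction `2` improves.
      have ha2 : a = 2 := by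
        have h0 := h.zero_lt
        have h1 := h.one_lt
        rcases (by fin_cases a <;> simp : a = 0 ∨ a = 1 ∨ a = 2) with rfl | rfl | rfl
        · exact absurd hyv h0.not_gt
        · exact absurd hyv h1.not_gt
        · rfl
      subst ha2
      refine ⟨none, (hs.none_iff w).2 ⟨j, ha⟩, ?_⟩
      rw [insertFrame_pos_inl, ← hy]
      rfl
    · refine ⟨some w', (hs.some_iff w w').2
        ⟨(insertVertex_lt_iff h hε).1 hlt, j, exchange_inr_inr.1 hj⟩, rfl⟩
  · rintro ⟨o, ho, rfl⟩
    rcases o with _ | w'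
    · obtain ⟨j, hj⟩ := (hs.none_iff w).1 ho
      exact ⟨Sum.inl ⟨_, hne⟩, ⟨⟨j, exchange_inr_inl_of_outer hj (F.nb_exchange v 2)⟩,
        hε.below _ h.two_lt w⟩, rfl⟩
    · obtain ⟨hlt, j, hj⟩ := (hs.some_iff w w').1 ho
      exact ⟨Sum.inr w', ⟨⟨j, exchange_inr_inr.2 hj⟩, (insertVertex_lt_iff h hε).2 hlt⟩, rfl⟩

theorem insertLP_expectedSteps_insertVertex [Nonempty V] (h : Compatible F v G)
    (hε : Small F v G ε) {f g : Fin r → Option (Fin r)} {e : Fin r → ℕ} (hs : G.Steps f g e)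
    {b : ℝ} (hb : 0 ≤ b) (hnb : L.expectedSteps (F.pos (F.nb v 2)) = ENNReal.ofReal b)
    (w : Fin r) :
    (F.insertLP v G ε).expectedSteps (F.insertVertex v G ε w) =
      ENNReal.ofReal (e w / 1024 + b) := by
  induction w using WellFoundedLT.induction with
  | _ w ih =>
    have key : ∀ o, (o = f w ∨ o = g w) → (F.insertLP v G ε).expectedSteps
        (o.elim (F.pos (F.nb v 2)) (F.insertVertex v G ε)) =
          ENNReal.ofReal ((o.elim 0 e : ℕ) / 1024 + b) := by
      rintro (_ | w') ho
      · simp only [Option.elim_none, Nat.cast_zero, zero_div, zero_add]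
        rw [← hnb, insertLP_expectedSteps_of_lt h hε _ h.two_lt]
      · exact ih w' ((hs.some_iff w w').1 ho).1
    refine expectedSteps_of_improving_eq_pair_ofReal _
      (insertLP_improving_insertVertex h hε hs w) (by positivity) (by positivity)
      (key _ (Or.inl rfl)) (key _ (Or.inr rfl)) ?_
    have := hs.two_mul w
    have h2 : (2 : ℝ) * e w = 2048 + (f w).elim 0 e + (g w).elim 0 e := by exact_mod_cast this
    linarith

end Frame
end LP3

/-! ### Integral polytopes and the extension step -/

namespace LP3

variable {n m r : ℕ}

/-- A polytope with integral constraints `normal i ⬝ᵥ x ≤ bound i`, listed by its integral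
vertices and the triples of tight constraints. The vertices are ordered by their objective
value. -/
structure IntPolytope (n r : ℕ) where
  normal : Fin n → Fin 3 → ℤ
  bound : Fin n → ℤ
  c : Fin 3 → ℤ
  y : Fin r → Fin 3 → ℤ
  t : Fin r → Fin 3 → Fin n

namespace IntPolytope

/-- The data describe a simple polytope with its vertices. -/
structure Valid (P : IntPolytope n r) : Prop where
  t_injective : ∀ w, Function.Injective (P.t w)
  tight : ∀ w i, (∃ j, P.t w j = i) → ∑ l, P.normal i l * P.y w l = P.bound i
  slack : ∀ w i, (¬ ∃ j, P.t w j = i) → ∑ l, P.normal i l * P.y w l < P.bound i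
  exists_exchange : ∀ w j, ∃ w', Exchange P.t w j w'
  covers : ∀ i, ∃ w j, P.t w j = i
  value_strictMono : StrictMono fun w => ∑ i, P.c i * P.y w i

/-- The linear program given by integral data. -/
noncomputable def toLP3 (P : IntPolytope n r) : LP3 n where
  normal i l := P.normal i l
  bound i := P.bound i
  objective l := P.c l

/-- The vertices of the linear program given by integral data. -/
noncomputable def frame (P : IntPolytope n r) (h : P.Valid) : Frame P.toLP3 (Fin r) where
  pos w l := P.y w l
  t := P.t
  t_injective := h.t_injective
  tight w j := by
    have := h.tight w _ ⟨j, rfl⟩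
    simp only [toLP3, dotProduct]
    exact_mod_cast this
  slack w i hi := by
    have := h.slack w i (by simpa using hi)
    simp only [toLP3, dotProduct]
    exact_mod_cast this
  exists_exchange := h.exists_exchange
  covers := h.covers
  value_injective w w' hw := by
    refine h.value_strictMono.injective ?_
    simp only [value, toLP3, dotProduct, Function.comp_apply] at hw
    exact_mod_cast hw

theorem value_lt_iff (P : IntPolytope n r) (h : P.Valid) {w w' : Fin r} :
    P.toLP3.value ((P.frame h).pos w) < P.toLP3.value ((P.frame h).pos w') ↔ w < w' := by
  rw [← h.value_strictMono.lt_iff_lt]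
  simp only [value, toLP3, dotProduct, frame]
  exact_mod_cast Iff.rfl

/-- The improving neighbours of the vertices below `s` other than the lowest vertex are `f w` and
`g w`; `1024` times the expected number of steps is `e w`. -/
structure Steps [NeZero r] (P : IntPolytope n r) (s : Fin r) (f g : Fin r → Fin r)
    (e : Fin r → ℕ) : Prop where
  lower_iff : ∀ w, w ≠ 0 → w ≤ s → ∀ w', (w' = f w ∨ w' = g w) ↔
    w' < w ∧ ∃ j, Exchange P.t w j w'
  zero : e 0 = 0
  two_mul : ∀ w, w ≠ 0 → w ≤ s → 2 * e w = 2048 + e (f w) + e (g w)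

theorem Steps.expectedSteps [NeZero r] {P : IntPolytope n r} {s : Fin r} {f g : Fin r → Fin r}
    {e : Fin r → ℕ} (hs : P.Steps s f g e) (h : P.Valid) (w : Fin r) (hw : w ≤ s) :
    P.toLP3.expectedSteps ((P.frame h).pos w) = ENNReal.ofReal (e w / 1024) := by
  induction w using WellFoundedLT.induction with
  | _ w ih =>
    have himp : P.toLP3.improving ((P.frame h).pos w) =
        (P.frame h).pos '' {w' | (∃ j, Exchange P.t w j w') ∧ w' < w} := by
      rw [Frame.improving_eq]
      simp only [P.value_lt_iff h]
      rfl
    by_cases h0 : w = 0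
    · subst h0
      rw [hs.zero, Nat.cast_zero, zero_div, ENNReal.ofReal_zero]
      refine expectedSteps_of_improving_eq_empty _ ?_
      rw [himp, Set.image_eq_empty, Set.eq_empty_iff_forall_notMem]
      rintro w' ⟨-, hw'⟩
      exact (Fin.zero_le w').not_gt hw'
    · have hpair : {w' | (∃ j, Exchange P.t w j w') ∧ w' < w} = {f w, g w} := by
        ext w'
        rw [Set.mem_insert_iff, Set.mem_singleton_iff, hs.lower_iff w h0 hw w', and_comm]
        rfl
      rw [hpair, Set.image_pair] at himp
      have key : ∀ w', (w' = f w ∨ w' = g w) → P.toLP3.expectedSteps ((P.frame h).pos w') =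
          ENNReal.ofReal (e w' / 1024) := fun w' hw' =>
        have hlt := ((hs.lower_iff w h0 hw w').1 hw').1
        ih w' hlt (hlt.le.trans hw)
      refine expectedSteps_of_improving_eq_pair_ofReal _ himp (by positivity) (by positivity)
        (key _ (Or.inl rfl)) (key _ (Or.inr rfl)) ?_
      have h2 : (2 : ℝ) * e w = 2048 + e (f w) + e (g w) := by
        exact_mod_cast hs.two_mul w h0 hw
      linarith

end IntPolytope

/-- There is a simple generic linear program with `n` facets that has a vertex with exactly one
improving neighbour, and the random edge rule takes `b` expected steps from that neighbour. -/
def Extendable (n : ℕ) (b : ℝ) : Prop :=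
  ∃ (L : LP3 n) (V : Type) (_ : Finite V) (F : Frame L V) (v : V),
    L.value (F.pos v) < L.value (F.pos (F.nb v 0)) ∧
    L.value (F.pos v) < L.value (F.pos (F.nb v 1)) ∧
    L.value (F.pos (F.nb v 2)) < L.value (F.pos v) ∧
    L.expectedSteps (F.pos (F.nb v 2)) = ENNReal.ofReal b

theorem Frame.nb_eq {L : LP3 n} {V : Type} (F : Frame L V) {x y : V} {j : Fin 3}
    (h : Exchange F.t x j y) : F.nb x j = y :=
  (F.nb_exchange x j).unique h

theorem IntPolytope.extendable [NeZero r] {P : IntPolytope n r} (h : P.Valid) {s : Fin r}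
    {f g : Fin r → Fin r} {e : Fin r → ℕ} (hs : P.Steps s f g e) {v y₀ y₁ : Fin r}
    (h₀ : Exchange P.t v 0 y₀) (h₁ : Exchange P.t v 1 y₁) (h₂ : Exchange P.t v 2 s)
    (hlt₀ : v < y₀) (hlt₁ : v < y₁) (hlt₂ : s < v) {a : ℕ} (ha : e s = a) :
    Extendable n (a / 1024) := by
  subst ha
  refine ⟨P.toLP3, Fin r, inferInstance, P.frame h, v, ?_, ?_, ?_, ?_⟩
  · rwa [(P.frame h).nb_eq h₀, P.value_lt_iff h]
  · rwa [(P.frame h).nb_eq h₁, P.value_lt_iff h]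
  · rwa [(P.frame h).nb_eq h₂, P.value_lt_iff h]
  · rw [(P.frame h).nb_eq h₂]
    exact hs.expectedSteps h s le_rfl

namespace Extendable

variable {b : ℝ} {G : Gadget m r} {f g : Fin r → Option (Fin r)} {e : Fin r → ℕ}

/-- The gadget vertex `q` becomes the next bottleneck: one edge goes up along the old direction `0`,
one up to `p` within the gadget, and the only improving one goes to `s`. -/
theorem insert (hE : Extendable n b) (hb : 0 ≤ b) (hG : G.Valid) (hs : G.Steps f g e)
    {q p s : Fin r} (h₀ : G.Outer q 0 0) (h₁ : Exchange G.t q 1 p) (h₂ : Exchange G.t q 2 s)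
    (hqp : q < p) (hsq : s < q) {a : ℕ} (ha : e s = a) : Extendable (n + m) (a / 1024 + b) := by
  subst ha
  obtain ⟨L, V, _, F, v, hv0, hv1, hv2, hv⟩ := hE
  have : Nonempty V := ⟨v⟩
  have h : F.Compatible v G := ⟨hG, hv0, hv1, hv2⟩
  obtain ⟨ε, hε⟩ := h.exists_small
  have hne : F.nb v 0 ≠ v := fun he => (F.nb_exchange v 0).pos_ne (by rw [he])
  let F' := Frame.insertFrame h hε
  have e0 : F'.nb (Sum.inr q) 0 = Sum.inl ⟨_, hne⟩ :=
    F'.nb_eq (Frame.exchange_inr_inl_of_outer h₀ (F.nb_exchange v 0))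
  have e1 : F'.nb (Sum.inr q) 1 = Sum.inr p := F'.nb_eq (Frame.exchange_inr_inr.2 h₁)
  have e2 : F'.nb (Sum.inr q) 2 = Sum.inr s := F'.nb_eq (Frame.exchange_inr_inr.2 h₂)
  refine ⟨F.insertLP v G ε, _, inferInstance, F', Sum.inr q, ?_, ?_, ?_, ?_⟩
  · rw [e0]
    exact hε.above _ hv0 q
  · rw [e1]
    exact (Frame.insertVertex_lt_iff h hε).2 hqp
  · rw [e2]
    exact (Frame.insertVertex_lt_iff h hε).2 hsq
  · rw [e2]
    exact Frame.insertLP_expectedSteps_insertVertex h hε hs hb hv s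

theorem exists_isSimpleGeneric (hE : Extendable n b) (hb : 0 ≤ b) (hG : G.Valid)
    (hs : G.Steps f g e) {w : Fin r} {a : ℕ} (ha : e w = a) :
    ∃ L : LP3 (n + m), L.IsSimpleGeneric ∧
      ∃ v ∈ L.vertices, L.expectedSteps v = ENNReal.ofReal (a / 1024 + b) := by
  subst ha
  obtain ⟨L, V, _, F, v, hv0, hv1, hv2, hv⟩ := hE
  have : Nonempty V := ⟨v⟩
  have h : F.Compatible v G := ⟨hG, hv0, hv1, hv2⟩
  obtain ⟨ε, hε⟩ := h.exists_small
  have : Nonempty ({x // x ≠ v} ⊕ Fin r) := ⟨Sum.inr w⟩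
  let F' := Frame.insertFrame h hε
  exact ⟨F.insertLP v G ε, F'.isSimpleGeneric, F'.pos (Sum.inr w), F'.mem_vertices _,
    Frame.insertLP_expectedSteps_insertVertex h hε hs hb hv w⟩

end Extendable

end LP3

/-! ### The explicit gadgets and the start polytope -/

namespace LP3

/-- The gadget that replaces a vertex with one improving edge; it is entered through the edge in
direction `0`. -/
def entryGadget : Gadget 10 21 where
  g := ![![3, 2, 3], ![3, 4, 11], ![3, 5, 15], ![21, 8, 18], ![73, 14, 9], ![12, 29, 108], ![51,
    52, 171], ![12, 5, 15], ![395, 74, 75], ![735, 290, 63]]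
  β := ![6912, 11520, 12096, 32256, 34560, 50112, 162432, 20016, 223488, 278208]
  c := ![63, 16, -3]
  y := ![![0, 0, 4416], ![0, 189, 3546], ![162, 0, 2526], ![216, 0, 2088], ![72, 1152, 1464], ![0,
    1512, 1488], ![0, 2112, 896], ![0, 2304, 768], ![0, 4032, 0], ![128, 3696, 0], ![448, 2640,
    96], ![608, 2544, 0], ![640, 2496, 0], ![888, 2016, 72], ![1056, 2088, 0], ![1728, 0, 576],
    ![3072, 576, 0], ![3312, 0, 144], ![3712, 192, 0], ![3852, 0, 36], ![4176, 0, 0]]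
  t := ![![.inl 0, .inl 1, .inr 9], ![.inl 0, .inr 4, .inr 9], ![.inl 1, .inr 4, .inr 9], ![.inl 1,
    .inr 0, .inr 4], ![.inr 0, .inr 4, .inr 8], ![.inl 0, .inr 4, .inr 8], ![.inl 0, .inr 0,
    .inr 8], ![.inl 0, .inr 0, .inr 3], ![.inl 0, .inl 2, .inr 3], ![.inl 2, .inr 3, .inr 7],
    ![.inr 0, .inr 3, .inr 7], ![.inl 2, .inr 0, .inr 7], ![.inl 2, .inr 0, .inr 6], ![.inr 0,
    .inr 1, .inr 6], ![.inl 2, .inr 1, .inr 6], ![.inl 1, .inr 0, .inr 1], ![.inl 2, .inr 1,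
    .inr 2], ![.inl 1, .inr 1, .inr 2], ![.inl 2, .inr 2, .inr 5], ![.inl 1, .inr 2, .inr 5],
    ![.inl 1, .inl 2, .inr 5]]

theorem entryGadget_valid : entryGadget.Valid where
  g_pos := by decide +kernel
  β_pos := by decide +kernel
  c_zero_pos := by decide +kernel
  c_one_pos := by decide +kernel
  c_two_neg := by decide +kernel
  t_injective := by decide +kernel
  axis_tight := by decide +kernel
  axis_slack := by decide +kernel
  facet_tight := by decide +kernel
  facet_slack := by decide +kernel
  exists_exchange := by decide +kernel
  exists_entry := by decide +kernel
  covers := by decide +kernel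
  exists_facet := by decide +kernel
  value_strictMono := fun w w' => by revert w w'; decide +kernel

/-- All expectations are dyadic, and the factor `1024` clears their denominators. Only vertex `0`
has the outgoing improving edge, and its value `1024` counts the step along it. -/
theorem entryGadget_steps : entryGadget.Steps
    ![none, some 0, some 1, some 2, some 3, some 1, some 5, some 6, some 7, some 8, some 7,
      some 10, some 11, some 12, some 13, some 3, some 14, some 15, some 16, some 17, some 19]
    ![none, some 0, some 0, some 2, some 3, some 4, some 4, some 6, some 7, some 8, some 9,
      some 9, some 11, some 12, some 12, some 13, some 14, some 16, some 16, some 18, some 18]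
    ![1024, 2048, 2560, 3584, 4608, 4352, 5504, 6528, 7552, 8576, 8576, 9600, 10624, 11648,
      12160, 8640, 13184, 11936, 14208, 14096, 15176] where
  some_iff := by decide +kernel
  none_iff := by decide +kernel
  two_mul := by decide +kernel

/-- The gadget `entryGadget` together with the truncation of the vertex that it replaces. -/
def chainGadget : Gadget 11 23 where
  g := ![![8, 3, 6], ![20, 27, 6], ![4, 5, 2], ![22, 27, 12], ![13, 6, 6], ![332, 261, 42], ![35,
    27, 24], ![680, 837, 330], ![140, 63, 78], ![272, 225, 42], ![764, 837, 42]]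
  β := ![27648, 55296, 13056, 73728, 34128, 435456, 120672, 2191104, 410400, 417312, 508032]
  c := ![98, 54, -56]
  y := ![![0, 0, 12096], ![0, 126, 9585], ![168, 0, 9040], ![252, 0, 8376], ![168, 224, 7648], ![0,
    504, 7236], ![0, 840, 5436], ![0, 1008, 4680], ![0, 2160, 3528], ![216, 1800, 3420], ![756,
    756, 3294], ![972, 666, 2979], ![1080, 612, 2862], ![1728, 192, 2592], ![1584, 432, 2280],
    ![2016, 0, 2496], ![1728, 384, 2112], ![2304, 0, 1920], ![2400, 192, 1312], ![2976, 0, 688],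
    ![3360, 0, 128], ![3456, 0, 0], ![0, 9216, 0]]
  t := ![![.inl 0, .inl 1, .inr 10], ![.inl 0, .inr 5, .inr 10], ![.inl 1, .inr 5, .inr 10], ![.inl
    1, .inr 1, .inr 5], ![.inr 1, .inr 5, .inr 9], ![.inl 0, .inr 5, .inr 9], ![.inl 0, .inr 1,
    .inr 9], ![.inl 0, .inr 1, .inr 4], ![.inl 0, .inr 0, .inr 4], ![.inr 0, .inr 4, .inr 8],
    ![.inr 1, .inr 4, .inr 8], ![.inr 0, .inr 1, .inr 8], ![.inr 0, .inr 1, .inr 7], ![.inr 1,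
    .inr 2, .inr 7], ![.inr 0, .inr 2, .inr 7], ![.inl 1, .inr 1, .inr 2], ![.inr 0, .inr 2,
    .inr 3], ![.inl 1, .inr 2, .inr 3], ![.inr 0, .inr 3, .inr 6], ![.inl 1, .inr 3, .inr 6],
    ![.inl 1, .inr 0, .inr 6], ![.inr 0, .inl 1, .inl 2], ![.inl 0, .inl 2, .inr 0]]

theorem chainGadget_valid : chainGadget.Valid where
  g_pos := by decide +kernel
  β_pos := by decide +kernel
  c_zero_pos := by decide +kernel
  c_one_pos := by decide +kernel
  c_two_neg := by decide +kernel
  t_injective := by decide +kernel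
  axis_tight := by decide +kernel
  axis_slack := by decide +kernel
  facet_tight := by decide +kernel
  facet_slack := by decide +kernel
  exists_exchange := by decide +kernel
  exists_entry := by decide +kernel
  covers := by decide +kernel
  exists_facet := by decide +kernel
  value_strictMono := fun w w' => by revert w w'; decide +kernel

/-- The first 21 entries agree with those of `entryGadget`; the truncating facet plays the role of
its axis constraint `2`. Vertices `21` and `22` are the two upper corners created by the truncation.
-/
theorem chainGadget_steps : chainGadget.Steps
    ![none, some 0, some 1, some 2, some 3, some 1, some 5, some 6, some 7, some 8, some 7,
      some 10, some 11, some 12, some 13, some 3, some 14, some 15, some 16, some 17, some 19,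
      some 20, some 21]
    ![none, some 0, some 0, some 2, some 3, some 4, some 4, some 6, some 7, some 8, some 9,
      some 9, some 11, some 12, some 12, some 13, some 14, some 16, some 16, some 18, some 18,
      some 20, some 8]
    ![1024, 2048, 2560, 3584, 4608, 4352, 5504, 6528, 7552, 8576, 8576, 9600, 10624, 11648,
      12160, 8640, 13184, 11936, 14208, 14096, 15176, 16200, 12900] where
  some_iff := by decide +kernel
  none_iff := by decide +kernel
  two_mul := by decide +kernel

/-- A tetrahedron whose sink has been replaced by a gadget. -/
def startPolytope : IntPolytope 14 24 where
  normal := ![![-1, 0, 0], ![0, -1, 0], ![0, 0, -1], ![75, 25, 3], ![-1, -1, -2], ![-2, -3, -8], ![-1,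
    -5, -46], ![-3, -2, -5], ![-206, -77, -28], ![-36, -187, -1908], ![-14, -15, -64], ![-35,
    -26, -85], ![-335, -98, -70], ![-398, -301, -28]]
  bound := ![0, 0, 0, 345600, -2304, -5184, -4104, -5184, -80640, -150012, -33408, -66816, -147168,
    -96768]
  c := ![96, 48, 4]
  y := ![![0, 0, 3456], ![0, 72, 2682], ![84, 0, 2262], ![252, 0, 1026], ![168, 256, 940], ![0,
    576, 1296], ![0, 1056, 624], ![0, 1152, 576], ![0, 2592, 0], ![144, 2376, 0], ![504, 1656,
    72], ![768, 1536, 0], ![1152, 1152, 0], ![1764, 504, 18], ![2016, 0, 144], ![1872, 480, 0],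
    ![1944, 432, 0], ![2448, 0, 36], ![2484, 324, 0], ![3690, 0, 9], ![4167, 0, 0], ![4608, 0,
    0], ![0, 0, 115200], ![0, 13824, 0]]
  t := ![![0, 1, 13], ![0, 8, 13], ![1, 8, 13], ![1, 4, 8], ![4, 8, 12], ![0, 8, 12], ![0, 4, 12],
    ![0, 4, 7], ![0, 2, 7], ![2, 7, 11], ![4, 7, 11], ![2, 4, 11], ![2, 4, 10], ![4, 5, 10],
    ![1, 4, 5], ![2, 5, 10], ![2, 5, 6], ![1, 5, 6], ![2, 6, 9], ![1, 6, 9], ![1, 2, 9], ![1, 2,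
    3], ![0, 1, 3], ![0, 2, 3]]

theorem startPolytope_valid : startPolytope.Valid where
  t_injective := by decide +kernel
  tight := by decide +kernel
  slack := by decide +kernel
  exists_exchange := by decide +kernel
  covers := by decide +kernel
  value_strictMono := fun w w' => by revert w w'; decide +kernel

theorem startPolytope_steps : startPolytope.Steps 20
    ![0, 0, 1, 2, 3, 1, 5, 6, 7, 8, 7, 10, 11, 12, 3, 13, 15, 14, 16, 17, 19, 0, 0, 0]
    ![0, 0, 0, 2, 3, 4, 4, 6, 7, 8, 9, 9, 11, 12, 13, 12, 15, 16, 16, 18, 18, 0, 0, 0]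
    ![0, 1024, 1536, 2560, 3584, 3328, 4480, 5504, 6528, 7552, 7552, 8576, 9600, 10624, 7616,
      11136, 12160, 10912, 13184, 13072, 14152, 0, 0, 0] where
  lower_iff := by decide +kernel
  zero := by decide +kernel
  two_mul := by decide +kernel

end LP3

/-! ### Chaining the gadgets and passing to the limit -/

namespace LP3

theorem extendable_chain (j : ℕ) : Extendable (14 + 11 * j) (1897 / 128 * (j + 1) - 1) := by
  induction j with
  | zero =>
    -- The walk ends at the sink instead of leaving the gadget by one more step: `14152 = 15176 -
    -- 1024`. This is the `- 1` in the statement.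
    have h := IntPolytope.extendable startPolytope_valid startPolytope_steps
      (v := 21) (y₀ := 23) (y₁ := 22) (by decide +kernel) (by decide +kernel) (by decide +kernel)
      (by decide) (by decide) (by decide) (a := 14152) rfl
    convert h using 1
    norm_num
  | succ j ih =>
    have hb : (0 : ℝ) ≤ 1897 / 128 * (j + 1) - 1 := by
      have : (0 : ℝ) ≤ j := j.cast_nonneg
      linarith
    -- The triple of vertex `21` is ordered so that dropping its entries leads, in turn, out along
    -- direction `0`, up to `22`, and down to `20`, as required of a bottleneck.
    have h := ih.insert hb chainGadget_valid chainGadget_steps (q := 21) (p := 22) (s := 20)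
      (by decide +kernel) (by decide +kernel) (by decide +kernel) (by decide) (by decide) (a := 15176) rfl
    convert h using 1
    · ring
    · push_cast
      ring

theorem exists_isSimpleGeneric_expectedSteps_eq (k n : ℕ) (hk : 4 ≤ k) (hn : n = k + 10 * (k - 2)) :
    ∃ L : LP3 n, L.IsSimpleGeneric ∧ ∃ v ∈ L.vertices,
      L.expectedSteps v = ENNReal.ofReal (1897 / 1408 * (n : ℝ) - 5202 / 1408) := by
  obtain ⟨j, rfl⟩ := Nat.exists_eq_add_of_le' hk
  -- The start polytope, `j` chain gadgets and one final entry gadget.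
  obtain rfl : n = 14 + 11 * j + 10 := by omega
  have hb : (0 : ℝ) ≤ 1897 / 128 * (j + 1) - 1 := by
    have : (0 : ℝ) ≤ j := j.cast_nonneg
    linarith
  obtain ⟨L, hL, v, hv, hE⟩ :=
    (extendable_chain j).exists_isSimpleGeneric hb entryGadget_valid entryGadget_steps
      (w := 20) (a := 15176) rfl
  refine ⟨L, hL, v, hv, hE.trans (congrArg _ ?_)⟩
  push_cast
  norm_num
  ring

end LP3

-- The construction reaches only the facet numbers `11 * j + 24`, which suffices: the limsup along a
-- subsequence is at most the full limsup.
open Filter Topology in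
theorem le_linearityCoefficientRE : ENNReal.ofReal (1897 / 1408) ≤ linearityCoefficientRE := by
  let φ : ℕ → ℕ := fun j => 11 * j + 24
  have hφ : Tendsto φ atTop atTop :=
    tendsto_atTop_mono (fun j => by simp only [φ, id]; omega) tendsto_id
  have hle : ∀ j, ENNReal.ofReal (1897 / 1408 - 5202 / 1408 / (φ j : ℝ)) ≤
      maxExpectedStepsRE (φ j) / (φ j : ℝ≥0∞) := by
    intro j
    obtain ⟨L, hL, v, hv, hE⟩ := LP3.exists_isSimpleGeneric_expectedSteps_eq (j + 4) (φ j)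
      (by omega) (by simp only [φ]; omega)
    have hpos : (0 : ℝ) < φ j := by simp only [φ]; positivity
    have hmax : L.expectedSteps v ≤ maxExpectedStepsRE (φ j) :=
      le_iSup₂_of_le L hL (le_iSup₂_of_le v hv le_rfl)
    rw [hE] at hmax
    calc ENNReal.ofReal (1897 / 1408 - 5202 / 1408 / (φ j : ℝ))
        = ENNReal.ofReal ((1897 / 1408 * (φ j : ℝ) - 5202 / 1408) / (φ j : ℝ)) := by
          congr 1
          field_simp
      _ = ENNReal.ofReal (1897 / 1408 * (φ j : ℝ) - 5202 / 1408) / (φ j : ℝ≥0∞) := by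
          rw [ENNReal.ofReal_div_of_pos hpos, ENNReal.ofReal_natCast]
      _ ≤ _ := ENNReal.div_le_div_right hmax _
  have hlim : Tendsto (fun j => ENNReal.ofReal (1897 / 1408 - 5202 / 1408 / (φ j : ℝ))) atTop
      (𝓝 (ENNReal.ofReal (1897 / 1408))) := by
    refine ENNReal.tendsto_ofReal ?_
    have h : Tendsto (fun j => 5202 / 1408 / (φ j : ℝ)) atTop (𝓝 0) :=
      tendsto_const_nhds.div_atTop (tendsto_natCast_atTop_atTop.comp hφ)
    simpa using (tendsto_const_nhds (x := (1897 / 1408 : ℝ))).sub h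
  rw [← hlim.limsup_eq]
  calc limsup (fun j => ENNReal.ofReal (1897 / 1408 - 5202 / 1408 / (φ j : ℝ))) atTop
      ≤ limsup (fun j => maxExpectedStepsRE (φ j) / (φ j : ℝ≥0∞)) atTop :=
        limsup_le_limsup (Eventually.of_forall hle)
    _ = limsup (fun n : ℕ => maxExpectedStepsRE n / (n : ℝ≥0∞)) (map φ atTop) := rfl
    _ ≤ _ := limsup_le_limsup_of_le hφ

theorem mainTheorem2 :
    (∀ k n : ℕ, 4 ≤ k → n = k + 10 * (k - 2) →
      ∃ L : LP3 n, L.IsSimpleGeneric ∧ ∃ v ∈ L.vertices,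
        L.expectedSteps v = ENNReal.ofReal (1897 / 1408 * (n : ℝ) - 5202 / 1408)) ∧
    ENNReal.ofReal (1897 / 1408) ≤ linearityCoefficientRE ∧
    (1.3473 : ℝ) < 1897 / 1408 :=
  ⟨LP3.exists_isSimpleGeneric_expectedSteps_eq, le_linearityCoefficientRE, by norm_num⟩
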